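/- For $k>0$ let $\beta_c(k)=\sqrt{2\pi}/k$. **Definitions.** Let $G=(V,E)$ be a finite graph with $n=|V|$ vertices, $\mathcal J=\{J_e\}_{e\in E}$ real numbers, and $\beta,d,\varepsilon>0$. Paths are self-avoiding and may have length $0$; the length of a path is its number of edges. For $e\in E$ and $u\in V$ let $$\Gamma_e=\frac{|1-\exp(\beta J_e)|}{1+\exp(\beta J_e)},\qquad A(u)=\sum_{w\sim u}\Gamma_{\{u,w\}},\qquad M(u)=\begin{cases}1-\varepsilon/4 & \text{if } A(u)\le 1-\varepsilon/2,\\ d\cdot A(u) & \text{otherwise,}\end{cases}$$ and for a path $P=(w_0,\dots,w_\ell)$ let $M(P)=\prod_{i=0}^{\ell}M(w_i)$. A vertex $u$ is a *$(d,\varepsilon)$-block vertex* if $M(P)<1$ for every path $P$ of length at most $\log n$ starting at $u$. For $B\subseteq V$ let $\partial_{\rm out}B$ be the set of vertices outside $B$ that have a neighbour in $B$. A partition $\mathcal B$ of $V$ is a *$(d,\varepsilon)$-block partition* if for every $B\in\mathcal B$: 1. the subgraph induced by $B$ is a tree with at most one extra edge; 2. if $|B|\ge 2$, then (a) every $w\in\partial_{\rm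 out}B$ is a $(d,\varepsilon)$-block vertex; (b) every $w\in\partial_{\rm out}B$ has exactly one neighbour in $B$; (c) if $B$ contains a cycle, then the length of this cycle is at most $4\frac{\log n}{\log^4 d}$; (d) the distance of this cycle from $\partial_{\rm out}B$ is at least $\log^5 d$; 3. if $B=\{v\}$, then $v$ is a $(d,\varepsilon)$-block vertex. For a path $P$ let $$\Upsilon(P)=\beta\sum_{e}|J_e|+\sum_{v}\log\deg(v),$$ where the first sum is over all edges of $G$ with at least one endpoint in $P$ and the second is over all vertices of $P$. Let $\mathcal G(d,\varepsilon)$ be the set of triplets $(G,\mathcal J,\beta)$ such that: 1. $G$ admits a $(d,\varepsilon)$-block partition; 2. every path $P$ in $G$ of length at most $\frac{\log n}{\log^4 d}$ satisfies $\Upsilon(P)\le\frac{\log n}{\log^2 d}$; 3. every edge $e$ of $G$ satisfies $n^{-7/3}\le|J_e|\le 10\sqrt{\log n}$. **Theorem.** For every $\varepsilon>0$ there exists $d_0=d_0(\varepsilon)\ge 1$ such that for every real $d\ge d_0$ there exists $n_0=n_0(\varepsilon,d)$ such that for every $\beta$ with $0<\beta\le(1-\varepsilon)\beta_c(d)$ and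 every $n\ge n_0$ the following is true. Let $\mathbf G=\mathbf G(n,d/n)$ be the Erdős–Rényi random graph on $n$ vertices with edge probability $d/n$, and let $\boldsymbol{\mathcal J}=\{\mathbf J_e: e\in E(\mathbf G)\}$ be i.i.d. standard Gaussians. Then $$\Pr\left[(\mathbf G,\boldsymbol{\mathcal J},\beta)\in\mathcal G(d,\varepsilon)\right]\ge 1-n^{-1/4}.$$ -/

import Mathlib

open MeasureTheory ProbabilityTheory

noncomputable section

namespace EdwardsAnderson

/-- The critical inverse temperature `√(2π) / k`. -/
def betaC (k : ℝ) : ℝ := Real.sqrt (2 * Real.pi) / k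

section Weights

variable {V : Type*} [Fintype V]

/-- The influence of an edge whose coupling is `x`, at inverse temperature `β`. -/
def influence (β x : ℝ) : ℝ := |1 - Real.exp (β * x)| / (1 + Real.exp (β * x))

open Classical in
/-- The aggregate influence of a vertex: the sum of the influences of its incident edges.
Couplings are given by a function on all unordered pairs; here and below, only its values on
the edges of `G` are ever used. -/
def aggInfluence (G : SimpleGraph V) (J : Sym2 V → ℝ) (β : ℝ) (u : V) : ℝ :=
  ∑ w ∈ G.neighborFinset u, influence β (J s(u, w))

open Classical in
/-- The `(d, ε)` vertex weight. -/
def vertexWeight (d ε : ℝ) (G : SimpleGraph V) (J : Sym2 V → ℝ) (β : ℝ) (u : V) : ℝ :=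
  if aggInfluence G J β u ≤ 1 - ε / 2 then 1 - ε / 4 else d * aggInfluence G J β u

/-- The `(d, ε)` path weight: the product of the weights of all vertices of the path. -/
def pathWeight (d ε : ℝ) (G : SimpleGraph V) (J : Sym2 V → ℝ) (β : ℝ) {u v : V}
    (P : G.Walk u v) : ℝ :=
  (P.support.map (vertexWeight d ε G J β)).prod

/-- A `(d, ε)`-block vertex: every (self-avoiding) path of length at most `log n` that starts
there has weight less than `1`, where `n` is the number of vertices. -/
def IsBlockVertex (d ε : ℝ) (G : SimpleGraph V) (J : Sym2 V → ℝ) (β : ℝ) (u : V) : Prop :=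
  ∀ (v : V) (P : G.Walk u v), P.IsPath → (P.length : ℝ) ≤ Real.log (Fintype.card V) →
    pathWeight d ε G J β P < 1

/-- The outer boundary of a set of vertices: the vertices outside that have a neighbour
inside. -/
def outerBoundary (G : SimpleGraph V) (B : Set V) : Set V :=
  {w | w ∉ B ∧ ∃ v ∈ B, G.Adj w v}

/-- The set `B` induces a tree with at most one extra edge. -/
def IsTreePlusEdge (G : SimpleGraph V) (B : Set V) : Prop :=
  ∃ T : SimpleGraph B, T.IsTree ∧ T ≤ G.induce B ∧
    ((G.induce B).edgeSet \ T.edgeSet).Subsingleton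

/-- The vertex partition `𝓑` is a `(d, ε)`-block partition. -/
structure IsBlockPartition (d ε : ℝ) (G : SimpleGraph V) (J : Sym2 V → ℝ) (β : ℝ)
    (𝓑 : Set (Set V)) : Prop where
  isPartition : Setoid.IsPartition 𝓑
  treePlusEdge : ∀ B ∈ 𝓑, IsTreePlusEdge G B
  boundary_block : ∀ B ∈ 𝓑, B.Nontrivial → ∀ w ∈ outerBoundary G B, IsBlockVertex d ε G J β w
  boundary_unique : ∀ B ∈ 𝓑, B.Nontrivial → ∀ w ∈ outerBoundary G B, ∃! v, v ∈ B ∧ G.Adj w v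
  cycle_short : ∀ B ∈ 𝓑, B.Nontrivial → ∀ (v : V) (C : G.Walk v v), C.IsCycle →
    (∀ x ∈ C.support, x ∈ B) →
    (C.length : ℝ) ≤ 4 * (Real.log (Fintype.card V) / Real.log d ^ 4)
  cycle_far : ∀ B ∈ 𝓑, B.Nontrivial → ∀ (v : V) (C : G.Walk v v), C.IsCycle →
    (∀ x ∈ C.support, x ∈ B) →
    ∀ x ∈ C.support, ∀ w ∈ outerBoundary G B, Real.log d ^ 5 ≤ (G.dist x w : ℝ)
  singleton_block : ∀ v : V, {v} ∈ 𝓑 → IsBlockVertex d ε G J β v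

open Classical in
/-- The weight `Υ(P)`: `β` times the sum of `|J_e|` over all edges `e` of `G` with at least one
endpoint in `P`, plus the sum of `log deg v` over all vertices `v` of `P`. -/
def upsilon (G : SimpleGraph V) (J : Sym2 V → ℝ) (β : ℝ) {u v : V} (P : G.Walk u v) : ℝ :=
  β * (∑ e ∈ G.edgeFinset with ∃ x ∈ P.support, x ∈ e, |J e|) +
    ∑ x ∈ P.support.toFinset, Real.log (G.degree x)

/-- The triplet `(G, J, β)` belongs to the class `𝒢(d, ε)`. -/
structure MemClass (d ε : ℝ) (G : SimpleGraph V) (J : Sym2 V → ℝ) (β : ℝ) : Prop where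
  exists_blockPartition : ∃ 𝓑 : Set (Set V), IsBlockPartition d ε G J β 𝓑
  upsilon_le : ∀ (u v : V) (P : G.Walk u v), P.IsPath →
    (P.length : ℝ) ≤ Real.log (Fintype.card V) / Real.log d ^ 4 →
    upsilon G J β P ≤ Real.log (Fintype.card V) / Real.log d ^ 2
  coupling_bounds : ∀ e ∈ G.edgeSet,
    (Fintype.card V : ℝ) ^ (-(7 / 3) : ℝ) ≤ |J e| ∧
      |J e| ≤ 10 * Real.sqrt (Real.log (Fintype.card V))

end Weights

/-- The joint law of the Erdős–Rényi graph `G(n, d/n)` and the couplings. Independently of the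
graph, every unordered pair carries an independent standard Gaussian; thus, given the graph, the
couplings on its edges are i.i.d. standard Gaussians. The edge probability is `d / n` truncated
to `[0, 1]`, so it equals `d / n` as soon as `0 ≤ d ≤ n` and `n ≠ 0`. -/
def law (n : ℕ) (d : ℝ) : Measure (SimpleGraph (Fin n) × (Sym2 (Fin n) → ℝ)) :=
  (SimpleGraph.binomialRandom (Fin n) (Set.projIcc (0 : ℝ) 1 zero_le_one (d / n))).prod
    (Measure.pi fun _ : Sym2 (Fin n) => gaussianReal 0 1)

end EdwardsAnderson

end

/-!
Call a vertex heavy if its aggregate influence exceeds `1 - ε / 2`, and write `L = log n / log⁴ d`.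
A path of weight at least `1` must collect enough heavy vertices to compensate the factors
`1 - ε / 4` of all the others, so the whole argument rests on two facts about the random graph:
sets of about `L` vertices are no denser than unicyclic graphs, and heavy vertices are rare.

*Blocks.* Let `N` be the set of vertices that are not block vertices, and `U` the union of `N` and
of the neighbourhoods of radius about `log⁵ d` of the cycles of length at most `4 L`. The blocks are
the connected components of the graph induced on `U`, and the remaining vertices as singletons
(`exists_isBlockPartition`). Boundary vertices are then block vertices and far from short cycles by
construction. For the rest, a component has diameter of order `L`, because `N` contains no geodesic
of length `L`. It contains at most one short cycle, its core, and every vertex off the core has only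
one neighbour towards the core: two approaches close up either to a second short cycle or to a small
set with more edges than vertices (`exists_core`, `exists_excess_of_two_approaches`). Charging each
edge to its endpoint farther from the core shows that the component is a tree with at most one extra
edge, whose only possible cycle is the core.

*Geodesics of non-block vertices.* Cutting a heavy path when its weight first reaches `1` shows that
every `v` in `N` starts a path inside `N` of weight at least `1` (`exists_heavy_path`). On such a
path the logarithms of the weights of the heavy vertices (`heavyLog`) have average bounded
below. Along a geodesic in `N`, Vitali's covering lemma selects disjoint paths of this kind
whose union covers a positive fraction of the geodesic (`no_long_geodesic`). Together with the
geodesic they form a set of more than `L` vertices that spans at least as many edges as a tree and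
has large average `heavyLog`.

*Probabilities.* Except for the bounds on the couplings, each bad event asks for a set `W` of `k`
vertices that spans at least `j` edges, where either `j = k + 1`, or `j = k - 1` and a sum over the
vertices of `W` is large. The union bound runs over `W` and the `j` edges, whose number is
compensated by the probability `(d / n) ^ j` that the edges are present, up to a factor
`n * (C d) ^ k` or better (`law_exists_le`). The sum is treated by its exponential moment, which factorizes over
the pairs of vertices (`law_le_of_moment`). For heavy vertices the point is that `influence β x ≤ β |x| / 2` and
`E |x| = √(2 / π)`, so that at `β ≤ (1 - ε) √(2π) / d` a vertex has mean aggregate influence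
at most `1 - ε`, below the threshold `1 - ε / 2`. An exponential moment of order `ε d / 400` then
makes heaviness exponentially unlikely in `ε² d`, which beats every power of `d` lost in the union
bound (`law_exists_heavy_le_exp`). The bound on `Υ` is obtained in the same way from
`log x ≤ log d + x / d`, and the bounds on the couplings from the Gaussian density near zero and the
Gaussian tail. The union of all bad events has probability at most `n ^ (-1 / 4)`
(`law_not_memClass_le`).
-/

noncomputable section

namespace EdwardsAnderson

/-! ### Edges inside a vertex set -/

section InnerEdges

variable {V : Type*} {G : SimpleGraph V}

open Classical in
/-- The edges of `G` with both endpoints in the finite vertex set `W`. -/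
def innerEdges (G : SimpleGraph V) (W : Finset V) : Finset (Sym2 V) :=
  {e ∈ W.sym2 | e ∈ G.edgeSet}

open Classical in
lemma mem_innerEdges {W : Finset V} {e : Sym2 V} :
    e ∈ innerEdges G W ↔ (∀ x ∈ e, x ∈ W) ∧ e ∈ G.edgeSet := by
  rw [innerEdges, Finset.mem_filter, Finset.mem_sym2_iff]

open Classical in
lemma innerEdges_subset_sym2 (W : Finset V) : innerEdges G W ⊆ W.sym2 :=
  Finset.filter_subset _ _

open Classical in
lemma card_innerEdges_insert {W A : Finset V} {v : V} (hv : v ∉ W) (hA : A ⊆ W)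
    (hadj : ∀ a ∈ A, G.Adj v a) :
    (innerEdges G W).card + A.card ≤ (innerEdges G (insert v W)).card := by
  have hinj : (A.image fun a => s(v, a)).card = A.card := by
    refine Finset.card_image_of_injOn fun a _ b _ hab => ?_
    exact Sym2.congr_right.1 hab
  rw [← hinj, ← Finset.card_union_of_disjoint]
  · refine Finset.card_le_card fun e he => ?_
    rw [Finset.mem_union] at he
    rcases he with he | he
    · rw [mem_innerEdges] at he ⊢
      exact ⟨fun x hx => Finset.mem_insert_of_mem (he.1 x hx), he.2⟩
    · obtain ⟨a, ha, rfl⟩ := Finset.mem_image.1 he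
      rw [mem_innerEdges]
      refine ⟨fun x hx => ?_, hadj a ha⟩
      rcases Sym2.mem_iff.1 hx with rfl | rfl
      · exact Finset.mem_insert_self _ _
      · exact Finset.mem_insert_of_mem (hA ha)
  · rw [Finset.disjoint_left]
    intro e he he'
    obtain ⟨a, ha, rfl⟩ := Finset.mem_image.1 he'
    exact hv ((mem_innerEdges.1 he).1 v (Sym2.mem_mk_left _ _))

open Classical in
/-- Adjoining a walk that starts in `W` adds at least as many inner edges as vertices. -/
lemma card_le_innerEdges_union_support {a b : V} (p : G.Walk a b) {W : Finset V} {c : ℕ}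
    (ha : a ∈ W) (hW : W.card ≤ (innerEdges G W).card + c) :
    (W ∪ p.support.toFinset).card ≤ (innerEdges G (W ∪ p.support.toFinset)).card + c := by
  induction p generalizing W with
  | nil => simpa [ha] using hW
  | @cons u v w h p ih =>
    have hW' : (insert v W).card ≤ (innerEdges G (insert v W)).card + c := by
      by_cases hv : v ∈ W
      · rwa [Finset.insert_eq_of_mem hv]
      · have := card_innerEdges_insert (G := G) (A := {u}) hv (by simpa using ha)
          (by simpa using h.symm)
        rw [Finset.card_insert_of_notMem hv]
        simp only [Finset.card_singleton] at this
        omega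
    have key := ih (Finset.mem_insert_self v W) hW'
    have heq : insert v W ∪ p.support.toFinset = W ∪ (SimpleGraph.Walk.cons h p).support.toFinset := by
      ext x
      have hv : v ∈ p.support := p.start_mem_support
      simp only [Finset.mem_union, Finset.mem_insert, List.mem_toFinset,
        SimpleGraph.Walk.support_cons, List.mem_cons]
      constructor
      · rintro ((rfl | h) | h) <;> tauto
      · rintro (h | rfl | h) <;> tauto
    rwa [heq] at key

open Classical in
lemma card_support_toFinset_le {a b : V} (p : G.Walk a b) :
    p.support.toFinset.card ≤ p.length + 1 := by
  simpa using p.support.toFinset_card_le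

open Classical in
/-- If a vertex `v ∉ X` can be approached from `X` along two different edges, then `X` together
with the two approaches and `v` spans at least two edges more than a tree does. -/
lemma exists_excess_of_two_approaches {X : Finset V} (hX : X.card ≤ (innerEdges G X).card)
    {x₀ v a b : V} (hx₀ : x₀ ∈ X) (hv : v ∉ X) (hab : a ≠ b) (hva : G.Adj v a) (hvb : G.Adj v b)
    (p : G.Walk x₀ a) (q : G.Walk x₀ b) (hp : v ∉ p.support) (hq : v ∉ q.support) :
    ∃ W : Finset V, W.card ≤ X.card + p.length + q.length + 3 ∧
      W.card < (innerEdges G W).card := by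
  have h1 := card_le_innerEdges_union_support p (c := 0) hx₀ (by simpa using hX)
  have h2 := card_le_innerEdges_union_support q (c := 0)
    (Finset.mem_union_left p.support.toFinset hx₀) h1
  have hc1 := Finset.card_union_le (X ∪ p.support.toFinset) q.support.toFinset
  have hc2 := Finset.card_union_le X p.support.toFinset
  have hc3 := card_support_toFinset_le p
  have hc4 := card_support_toFinset_le q
  set Z := X ∪ p.support.toFinset ∪ q.support.toFinset with hZ
  have hvZ : v ∉ Z := by simp [hZ, hv, hp, hq]
  have h3 := card_innerEdges_insert (G := G) (A := {a, b}) hvZ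
    (by intro x hx; rcases Finset.mem_insert.1 hx with rfl | hx
        · simp [hZ]
        · rw [Finset.mem_singleton.1 hx]; simp [hZ])
    (by intro x hx; rcases Finset.mem_insert.1 hx with rfl | hx
        · exact hva
        · rw [Finset.mem_singleton.1 hx]; exact hvb)
  rw [Finset.card_pair hab] at h3
  refine ⟨insert v Z, ?_, ?_⟩
  · rw [Finset.card_insert_of_notMem hvZ]
    omega
  · rw [Finset.card_insert_of_notMem hvZ]
    omega

open Classical in
lemma _root_.SimpleGraph.Walk.IsCycle.card_support_toFinset {v : V} {C : G.Walk v v}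
    (hC : C.IsCycle) :
    C.support.toFinset.card = C.length := by
  have h : C.support.toFinset = C.support.tail.toFinset := by
    ext x
    simp only [List.mem_toFinset]
    rw [← SimpleGraph.Walk.cons_tail_support C]
    simp only [List.mem_cons, List.tail_cons]
    constructor
    · rintro (rfl | h)
      · exact SimpleGraph.Walk.end_mem_tail_support hC.not_nil
      · exact h
    · exact Or.inr
  rw [h, List.toFinset_card_of_nodup hC.support_nodup]
  simp

open Classical in
lemma card_cycle_le_innerEdges {v : V} {C : G.Walk v v} (hC : C.IsCycle) :
    C.support.toFinset.card ≤ (innerEdges G C.support.toFinset).card := by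
  rw [hC.card_support_toFinset]
  have : C.length = C.edges.toFinset.card := by
    rw [List.toFinset_card_of_nodup hC.edges_nodup]; simp
  rw [this]
  refine Finset.card_le_card fun e he => ?_
  rw [List.mem_toFinset] at he
  rw [mem_innerEdges]
  exact ⟨fun x hx => List.mem_toFinset.2 (C.mem_support_of_mem_edges he hx),
    C.edges_subset_edgeSet he⟩

/-- Every vertex of a cycle has two distinct neighbours on the cycle. -/
lemma exists_two_nbrs_of_mem_cycle {v x : V} {C : G.Walk v v} (hC : C.IsCycle)
    (hx : x ∈ C.support) :
    ∃ a b, a ≠ b ∧ a ∈ C.support ∧ b ∈ C.support ∧ G.Adj x a ∧ G.Adj x b := by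
  classical
  have hR := hC.rotate hx
  refine ⟨(C.rotate x hx).snd, (C.rotate x hx).penultimate, hR.snd_ne_penultimate, ?_, ?_, ?_, ?_⟩
  · exact (C.mem_support_rotate_iff x hx).1 (SimpleGraph.Walk.getVert_mem_support _ _)
  · exact (C.mem_support_rotate_iff x hx).1 (SimpleGraph.Walk.getVert_mem_support _ _)
  · exact SimpleGraph.Walk.adj_snd hR.not_nil
  · exact (SimpleGraph.Walk.adj_penultimate hR.not_nil).symm

/-- Two walks from a common vertex that approach `v` along different edges, without visiting `v`
before, close up to a cycle through both approaching edges. -/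
lemma exists_cycle_of_two_approaches {x₀ v a b : V} (hab : a ≠ b) (hva : G.Adj v a)
    (hvb : G.Adj v b) (p : G.Walk x₀ a) (q : G.Walk x₀ b) (hp : v ∉ p.support)
    (hq : v ∉ q.support) :
    ∃ C : G.Walk v v, C.IsCycle ∧ C.length ≤ p.length + q.length + 2 ∧ a ∈ C.support := by
  classical
  let r := (p.reverse.append q).bypass
  have hr : v ∉ r.support := fun h => by
    have := SimpleGraph.Walk.support_bypass_subset_support _ h
    rw [SimpleGraph.Walk.mem_support_append_iff, SimpleGraph.Walk.support_reverse,
      List.mem_reverse] at this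
    tauto
  have hrl : r.length ≤ p.length + q.length := by
    refine (SimpleGraph.Walk.length_bypass_le_length _).trans ?_
    simp
  have hrP : r.IsPath := SimpleGraph.Walk.bypass_isPath _
  have hP : (r.concat hvb.symm).IsPath := hrP.concat hr hvb.symm
  refine ⟨.cons hva (r.concat hvb.symm), ?_, ?_, ?_⟩
  · refine (SimpleGraph.Walk.cons_isCycle_iff _ _).2 ⟨hP, fun h => ?_⟩
    rw [SimpleGraph.Walk.edges_concat, List.concat_eq_append, List.mem_append] at h
    rcases h with h | h
    · exact hr (r.fst_mem_support_of_mem_edges h)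
    · rw [List.mem_singleton, Sym2.eq_iff] at h
      rcases h with ⟨h, -⟩ | ⟨-, h⟩
      · exact hvb.ne h
      · exact hab h
  · simp only [SimpleGraph.Walk.length_cons, SimpleGraph.Walk.length_concat]; omega
  · simp

end InnerEdges

/-! ### Sets that are trees up to one edge -/

section Excess

variable {V : Type*} {G : SimpleGraph V}

open Classical in
/-- A connected set with at most as many edges as vertices: take a spanning tree. -/
lemma isTreePlusEdge_of_card [Fintype V] {B : Set V} (hconn : (G.induce B).Connected)
    (hcard : (innerEdges G B.toFinset).card ≤ B.toFinset.card) : IsTreePlusEdge G B := by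
  obtain ⟨T, hle, hT⟩ := hconn.exists_isTree_le
  refine ⟨T, hT, hle, ?_⟩
  have hTc := hT.card_edgeFinset
  have hE : (G.induce B).edgeFinset.card ≤ (innerEdges G B.toFinset).card := by
    refine Finset.card_le_card_of_injOn (Sym2.map Subtype.val) ?_ ?_
    · intro e he
      induction e with | _ x y =>
      have he : (G.induce B).Adj x y := by simpa using he
      rw [Finset.mem_coe, mem_innerEdges]
      refine ⟨?_, by simpa using he⟩
      intro z hz
      simp only [Sym2.map_mk, Sym2.mem_iff] at hz
      rcases hz with rfl | rfl <;> simp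
    · exact (Sym2.map.injective Subtype.val_injective).injOn
  have hB : Fintype.card B = B.toFinset.card := (Set.toFinset_card B).symm
  have hsub : T.edgeFinset ⊆ (G.induce B).edgeFinset := SimpleGraph.edgeFinset_mono hle
  have hdiff : ((G.induce B).edgeFinset \ T.edgeFinset).card ≤ 1 := by
    rw [Finset.card_sdiff_of_subset hsub]; omega
  intro e he f hf
  refine Finset.card_le_one.1 hdiff e ?_ f ?_
  · simpa using he
  · simpa using hf

open Classical in
/-- Let `X ⊆ B` span at most as many edges as it has vertices, and let `ρ` be a height function,
zero on `X`, such that every vertex of `B` outside `X` has at most one neighbour in `B` that is not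
higher than itself. Then `B` spans at most as many edges as it has vertices: charge an edge to its
higher endpoint. -/
lemma card_innerEdges_le_of_height {B X : Finset V} (hXB : X ⊆ B)
    (hX : (innerEdges G X).card ≤ X.card) (ρ : V → ℕ) (hρ : ∀ x ∈ X, ρ x = 0)
    (huniq : ∀ v ∈ B, v ∉ X → ∀ a ∈ B, ∀ b ∈ B, G.Adj v a → G.Adj v b → ρ a ≤ ρ v → ρ b ≤ ρ v →
      a = b) :
    (innerEdges G B).card ≤ B.card := by
  have hXB' : innerEdges G X ⊆ innerEdges G B := fun e he => by
    rw [mem_innerEdges] at he ⊢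
    exact ⟨fun x hx => hXB (he.1 x hx), he.2⟩
  have h1 : (innerEdges G B \ innerEdges G X).card ≤ (B \ X).card := by
    refine Finset.card_le_card_of_forall_subsingleton
      (fun e v => ∃ a ∈ B, e = s(v, a) ∧ ρ a ≤ ρ v) ?_ ?_
    · intro e he
      rw [Finset.mem_sdiff, mem_innerEdges, mem_innerEdges] at he
      obtain ⟨⟨hB, hG⟩, hX'⟩ := he
      induction e with | _ x y =>
      have hx : x ∈ B := hB x (by simp)
      have hy : y ∈ B := hB y (by simp)
      have hxy : ¬ (x ∈ X ∧ y ∈ X) := fun h => hX' ⟨by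
        intro z hz
        rcases Sym2.mem_iff.1 hz with rfl | rfl
        exacts [h.1, h.2], hG⟩
      by_cases hx' : x ∈ X
      · have hy' : y ∉ X := fun h => hxy ⟨hx', h⟩
        exact ⟨y, by simp [hy, hy'], x, hx, Sym2.eq_swap, by simp [hρ x hx']⟩
      · by_cases hy' : y ∈ X
        · exact ⟨x, by simp [hx, hx'], y, hy, rfl, by simp [hρ y hy']⟩
        · rcases le_total (ρ x) (ρ y) with h | h
          · exact ⟨y, by simp [hy, hy'], x, hx, Sym2.eq_swap, h⟩
          · exact ⟨x, by simp [hx, hx'], y, hy, rfl, h⟩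
    · intro v hv e he f hf
      rw [Finset.mem_sdiff] at hv
      obtain ⟨he, a, ha, rfl, hav⟩ := he
      obtain ⟨hf, b, hb, rfl, hbv⟩ := hf
      have he := (mem_innerEdges.1 (Finset.mem_sdiff.1 he).1).2
      have hf := (mem_innerEdges.1 (Finset.mem_sdiff.1 hf).1).2
      rw [huniq v hv.1 hv.2 a ha b hb he hf hav hbv]
  rw [Finset.card_sdiff_of_subset hXB', Finset.card_sdiff_of_subset hXB] at h1
  have := Finset.card_le_card hXB'
  have := Finset.card_le_card hXB
  omega

/-- A highest vertex of a cycle outside `X` would have two neighbours that are not higher. -/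
lemma cycle_support_subset_of_height {B X : Set V} (ρ : V → ℕ)
    (huniq : ∀ v ∈ B, v ∉ X → ∀ a ∈ B, ∀ b ∈ B, G.Adj v a → G.Adj v b →
      (a ∈ X ∨ ρ a ≤ ρ v) → (b ∈ X ∨ ρ b ≤ ρ v) → a = b)
    {u : V} {C : G.Walk u u} (hC : C.IsCycle) (hB : ∀ x ∈ C.support, x ∈ B) :
    ∀ x ∈ C.support, x ∈ X := by
  classical
  by_contra! hcon
  obtain ⟨x, hx, hxX⟩ := hcon
  obtain ⟨v, hv, hmax⟩ := Finset.exists_max_image {x ∈ C.support.toFinset | x ∉ X} ρ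
    ⟨x, by simp [hx, hxX]⟩
  simp only [Finset.mem_filter, List.mem_toFinset] at hv hmax
  obtain ⟨a, b, hab, ha, hb, hva, hvb⟩ := exists_two_nbrs_of_mem_cycle hC hv.1
  refine hab (huniq v (hB v hv.1) hv.2 a (hB a ha) b (hB b hb) hva hvb ?_ ?_)
  · by_cases h : a ∈ X
    · exact Or.inl h
    · exact Or.inr (hmax a ⟨ha, h⟩)
  · by_cases h : b ∈ X
    · exact Or.inl h
    · exact Or.inr (hmax b ⟨hb, h⟩)

end Excess

/-! ### Walks that stay inside a vertex set -/

section Within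

variable {V : Type*} {G : SimpleGraph V}

/-- The graph on the same vertices whose edges are the edges of `G` inside `U`; vertices outside
`U` become isolated. -/
def within (G : SimpleGraph V) (U : Set V) : SimpleGraph V where
  Adj a b := G.Adj a b ∧ a ∈ U ∧ b ∈ U
  symm := ⟨fun _ _ h => ⟨h.1.symm, h.2.2, h.2.1⟩⟩
  loopless := ⟨fun _ h => h.1.ne rfl⟩

lemma within_le (U : Set V) : within G U ≤ G := fun _ _ h => h.1

lemma exists_walk_within {U : Set V} {a b : V} (p : G.Walk a b) (hp : ∀ x ∈ p.support, x ∈ U) :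
    ∃ q : (within G U).Walk a b, q.length = p.length := by
  induction p with
  | nil => exact ⟨.nil, rfl⟩
  | @cons u v w h p ih =>
    obtain ⟨q, hq⟩ := ih fun x hx => hp x (by simp [hx])
    have h' : (within G U).Adj u v := ⟨h, hp u (by simp), hp v (by simp)⟩
    exact ⟨.cons h' q, by rw [SimpleGraph.Walk.length_cons, SimpleGraph.Walk.length_cons, hq]⟩

lemma support_subset_of_within {U : Set V} {a b : V} (ha : a ∈ U) (p : (within G U).Walk a b) :
    ∀ x ∈ p.support, x ∈ U := by
  induction p with
  | nil => simpa using ha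
  | @cons u v w h p ih =>
    intro x hx
    rw [SimpleGraph.Walk.support_cons, List.mem_cons] at hx
    rcases hx with rfl | hx
    · exact ha
    · exact ih h.2.2 x hx

end Within

/-! ### Geodesics of non-block vertices -/

section Covering

variable {V : Type*} {G : SimpleGraph V}

open Classical in
/-- A covering argument. Let every vertex `v` of `N` lie in a set `F v`, reached by a walk inside
`U`, on which `h` has average at least `δ`, and suppose that no set of more than `ℓ` vertices that
spans as many edges as a tree has `h`-average `δ / 8`. Then `N` contains no geodesic of `G[U]` of
length `ℓ`: Vitali's lemma selects disjoint sets `F (q i)` that cover a positive fraction of the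
geodesic `q`, because sets that meet start at nearby points of a geodesic, and the union of `q` with
the selected sets has large average. -/
lemma no_long_geodesic {U N : Set V} {h : V → ℝ} (hh : ∀ v, 0 ≤ h v) {δ : ℝ} (hδ : 0 < δ)
    {ℓ : ℕ}
    (hN : ∀ v ∈ N, ∃ F : Finset V, v ∈ F ∧ δ * F.card ≤ ∑ x ∈ F, h x ∧
      (∀ x ∈ F, ∃ p : (within G U).Walk v x, p.length + 1 ≤ F.card) ∧
      ∀ W : Finset V, v ∈ W → W.card ≤ (innerEdges G W).card + 1 →
        (W ∪ F).card ≤ (innerEdges G (W ∪ F)).card + 1)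
    (hW : ∀ W : Finset V, ℓ + 1 ≤ W.card → W.card ≤ (innerEdges G W).card + 1 →
      ∑ x ∈ W, h x < δ / 8 * W.card)
    (q : ℕ → V) (hq : ∀ i ≤ ℓ, q i ∈ N) (hadj : ∀ i < ℓ, G.Adj (q i) (q (i + 1)))
    (hgeo : ∀ i j, i ≤ j → j ≤ ℓ → j - i ≤ (within G U).dist (q i) (q j)) : False := by
  choose! F hvF hF hwalk hgrow using hN
  obtain ⟨u, hut, hdisj, hcov⟩ := Vitali.exists_disjoint_subfamily_covering_enlargement
    (fun i : ℕ => (F (q i) : Set V)) (Set.Iic ℓ) (fun i => ((F (q i)).card : ℝ)) 2 (by norm_num)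
    (fun _ _ => Nat.cast_nonneg _) (∑ i ∈ Finset.range (ℓ + 1), ((F (q i)).card : ℝ))
    (fun a ha => Finset.single_le_sum (f := fun i => ((F (q i)).card : ℝ))
      (fun _ _ => Nat.cast_nonneg _) (by simpa [Nat.lt_succ_iff] using ha))
    (fun a ha => ⟨q a, hvF _ (hq a ha)⟩)
  have hufin : u.Finite := (Set.finite_Iic ℓ).subset hut
  obtain ⟨I, rfl⟩ := hufin.exists_finset_coe
  have hIℓ : ∀ i ∈ I, i ≤ ℓ := fun i hi => hut hi
  set s := ∑ i ∈ I, (F (q i)).card with hs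
  -- the selected sets cover the geodesic after a sevenfold enlargement
  have hcover : ℓ + 1 ≤ 7 * s := by
    have hsub : Finset.range (ℓ + 1) ⊆
        I.biUnion fun i => Finset.Icc (i - 3 * (F (q i)).card) (i + 3 * (F (q i)).card) := by
      intro a ha
      have ha : a ≤ ℓ := by simpa [Nat.lt_succ_iff] using ha
      obtain ⟨b, hb, ⟨x, hxa, hxb⟩, hab⟩ := hcov a ha
      have hab : (F (q a)).card ≤ 2 * (F (q b)).card := by exact_mod_cast hab
      obtain ⟨p, hp⟩ := hwalk _ (hq a ha) x hxa
      obtain ⟨p', hp'⟩ := hwalk _ (hq b (hIℓ b hb)) x hxb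
      have hd : (within G U).dist (q a) (q b) ≤ 3 * (F (q b)).card := by
        refine (SimpleGraph.dist_le (p.append p'.reverse)).trans ?_
        simp only [SimpleGraph.Walk.length_append, SimpleGraph.Walk.length_reverse]
        omega
      refine Finset.mem_biUnion.2 ⟨b, hb, Finset.mem_Icc.2 ?_⟩
      rcases le_total a b with h | h
      · have := hgeo a b h (hIℓ b hb)
        omega
      · have := hgeo b a h ha
        rw [SimpleGraph.dist_comm] at this
        omega
    have h1 := (Finset.card_le_card hsub).trans Finset.card_biUnion_le
    rw [Finset.card_range] at h1
    refine h1.trans ?_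
    rw [hs, Finset.mul_sum]
    refine Finset.sum_le_sum fun i hi => ?_
    have : 0 < (F (q i)).card := Finset.card_pos.2 ⟨_, hvF _ (hq i (hIℓ i hi))⟩
    rw [Nat.card_Icc]
    omega
  have hinj : Set.InjOn q (Finset.range (ℓ + 1) : Set ℕ) := by
    intro i hi j hj hij
    simp only [Finset.coe_range, Set.mem_Iio] at hi hj
    rcases le_total i j with h | h
    · have := hgeo i j h (by omega)
      rw [hij, SimpleGraph.dist_self] at this
      omega
    · have := hgeo j i h (by omega)
      rw [hij, SimpleGraph.dist_self] at this
      omega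
  have hQ : ∀ m ≤ ℓ, ((Finset.range (m + 1)).image q).card ≤
      (innerEdges G ((Finset.range (m + 1)).image q)).card + 1 := by
    intro m
    induction m with
    | zero => intro _; simp
    | succ m ih =>
      intro hm
      have := card_le_innerEdges_union_support (hadj m (by omega)).toWalk
        (W := (Finset.range (m + 1)).image q) (c := 1)
        (Finset.mem_image_of_mem _ (by simp)) (ih (by omega))
      have heq : (Finset.range (m + 1)).image q ∪ (hadj m (by omega)).toWalk.support.toFinset =
          (Finset.range (m + 1 + 1)).image q := by
        rw [Finset.range_add_one (n := m + 1), Finset.image_insert]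
        ext x
        have : q m ∈ (Finset.range (m + 1)).image q := Finset.mem_image_of_mem _ (by simp)
        simp only [Finset.mem_union, List.mem_toFinset, SimpleGraph.Walk.support_cons,
          SimpleGraph.Walk.support_nil, List.mem_cons, List.not_mem_nil, or_false,
          Finset.mem_insert]
        constructor
        · rintro (h | rfl | h) <;> tauto
        · rintro (h | h) <;> tauto
      rwa [heq] at this
  set W₀ := (Finset.range (ℓ + 1)).image q with hW₀
  have hW₀c : W₀.card = ℓ + 1 := by
    rw [hW₀, Finset.card_image_of_injOn hinj, Finset.card_range]
  have hunion : ∀ I' ⊆ I, (W₀ ∪ I'.biUnion fun i => F (q i)).card ≤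
      (innerEdges G (W₀ ∪ I'.biUnion fun i => F (q i))).card + 1 := by
    intro I'
    induction I' using Finset.induction_on with
    | empty => intro _; simpa using hQ ℓ le_rfl
    | insert i I' _ ih =>
      intro hI'
      have hi := hIℓ i (hI' (Finset.mem_insert_self _ _))
      have := hgrow (q i) (hq i hi) (W₀ ∪ I'.biUnion fun i => F (q i))
        (Finset.mem_union_left _ (Finset.mem_image_of_mem _ (by simpa [Nat.lt_succ_iff] using hi)))
        (ih fun x hx => hI' (Finset.mem_insert_of_mem hx))
      rw [Finset.biUnion_insert, Finset.union_comm (F (q i)), ← Finset.union_assoc]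
      exact this
  have hWe := hunion I subset_rfl
  set W := W₀ ∪ I.biUnion fun i => F (q i) with hWdef
  have hWl : ℓ + 1 ≤ W.card := hW₀c ▸ Finset.card_le_card Finset.subset_union_left
  have hWu : W.card ≤ 8 * s := by
    have h1 : W.card ≤ W₀.card + (I.biUnion fun i => F (q i)).card := Finset.card_union_le _ _
    have h2 : (I.biUnion fun i => F (q i)).card ≤ s := Finset.card_biUnion_le
    omega
  have hsum : δ * s ≤ ∑ x ∈ W, h x := by
    calc δ * s = ∑ i ∈ I, δ * ((F (q i)).card : ℝ) := by
          rw [hs, Nat.cast_sum, Finset.mul_sum]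
      _ ≤ ∑ i ∈ I, ∑ x ∈ F (q i), h x :=
          Finset.sum_le_sum fun i hi => hF _ (hq i (hIℓ i hi))
      _ = ∑ x ∈ I.biUnion fun i => F (q i), h x := by
          rw [Finset.sum_biUnion]
          intro i hi j hj hij
          exact Finset.disjoint_coe.1 (hdisj hi hj hij)
      _ ≤ ∑ x ∈ W, h x :=
          Finset.sum_le_sum_of_subset_of_nonneg Finset.subset_union_right fun _ _ _ => hh _
  have := hW W hWl hWe
  have h8 : (W.card : ℝ) ≤ 8 * s := by exact_mod_cast hWu
  nlinarith

end Covering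

/-! ### Non-block vertices -/

section NonBlock

variable {V : Type*} [Fintype V] {G : SimpleGraph V} {J : Sym2 V → ℝ} {d ε β : ℝ}

lemma influence_nonneg (β x : ℝ) : 0 ≤ influence β x := by unfold influence; positivity

/-- The logarithm of the weight of a heavy vertex, and `0` for a light vertex, i.e. for one of
aggregate influence at most `1 - ε / 2`. -/
def heavyLog (d ε : ℝ) (G : SimpleGraph V) (J : Sym2 V → ℝ) (β : ℝ) (u : V) : ℝ :=
  if aggInfluence G J β u ≤ 1 - ε / 2 then 0 else Real.log (d * aggInfluence G J β u)

/-- The set of vertices that are not block vertices. -/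
def nonBlock (d ε : ℝ) (G : SimpleGraph V) (J : Sym2 V → ℝ) (β : ℝ) : Set V :=
  {v | ¬ IsBlockVertex d ε G J β v}

lemma vertexWeight_pos (hε : 0 < ε) (hε1 : ε < 1) (hd : 4 ≤ d) (u : V) :
    0 < vertexWeight d ε G J β u := by
  unfold vertexWeight
  split_ifs with h
  · linarith
  · push Not at h
    have : 0 < aggInfluence G J β u := by linarith
    positivity

lemma one_sub_le_vertexWeight (hε : 0 < ε) (hε1 : ε < 1) (hd : 4 ≤ d) (u : V) :
    1 - ε / 4 ≤ vertexWeight d ε G J β u := by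
  unfold vertexWeight
  split_ifs with h
  · exact le_rfl
  · push Not at h
    nlinarith

lemma heavyLog_nonneg (hε1 : ε < 1) (hd : 4 ≤ d) (u : V) :
    0 ≤ heavyLog d ε G J β u := by
  unfold heavyLog
  split_ifs with h
  · exact le_rfl
  · push Not at h
    refine Real.log_nonneg ?_
    nlinarith

/-- A heavy vertex has weight at least `1 / (1 - ε / 4)`, so the factor `2` makes room for the
subtracted constant. Hence a path of weight at least `1` has large average `heavyLog`. -/
lemma log_vertexWeight_le (hε : 0 < ε) (hε1 : ε < 1) (hd : 4 ≤ d) (u : V) :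
    Real.log (vertexWeight d ε G J β u) ≤
      2 * heavyLog d ε G J β u - -Real.log (1 - ε / 4) := by
  unfold vertexWeight heavyLog
  split_ifs with h
  · simp
  · push Not at h
    have hA : 0 < aggInfluence G J β u := by linarith
    have h1 : 0 ≤ Real.log ((1 - ε / 4) * (d * aggInfluence G J β u)) := by
      refine Real.log_nonneg ?_
      nlinarith [mul_le_mul (show (3:ℝ) / 4 ≤ 1 - ε / 4 by linarith)
        (show 2 ≤ d * aggInfluence G J β u by nlinarith) (by norm_num) (by linarith)]
    rw [Real.log_mul (by linarith) (by positivity)] at h1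
    linarith

lemma pathWeight_nil (u : V) :
    pathWeight d ε G J β (SimpleGraph.Walk.nil : G.Walk u u) = vertexWeight d ε G J β u := by
  simp [pathWeight]

lemma pathWeight_cons {u v w : V} (h : G.Adj u v) (p : G.Walk v w) :
    pathWeight d ε G J β (SimpleGraph.Walk.cons h p) =
      vertexWeight d ε G J β u * pathWeight d ε G J β p := by
  simp [pathWeight]

/-- Cut a path at the first moment its accumulated weight, started from `x ≤ 1`, is at least `1`.
Every final segment of the result then has weight at least `1`, so that it consists of non-block
vertices. -/
lemma exists_heavy_prefix (hε : 0 < ε) (hε1 : ε < 1) (hd : 4 ≤ d) {u v : V} (P : G.Walk u v)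
    (hP : P.IsPath) (hlen : (P.length : ℝ) ≤ Real.log (Fintype.card V)) {x : ℝ} (hx0 : 0 < x)
    (hx : x ≤ 1) (hw : 1 ≤ x * pathWeight d ε G J β P) :
    ∃ (z : V) (Q : G.Walk u z), Q.IsPath ∧ Q.length ≤ P.length ∧ Q.support ⊆ P.support ∧
      1 ≤ x * pathWeight d ε G J β Q ∧ ∀ y ∈ Q.support, y ∈ nonBlock d ε G J β := by
  have key : ∀ {a b : V} (Q : G.Walk a b), Q.IsPath → Q.length ≤ P.length → ∀ {t : ℝ}, 0 < t →
      t ≤ 1 → 1 ≤ t * pathWeight d ε G J β Q → a ∈ nonBlock d ε G J β := by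
    intro a b Q hQ hl t ht0 ht h1 hblock
    have := hblock b Q hQ ((Nat.cast_le.2 hl).trans hlen)
    nlinarith
  induction P generalizing x with
  | nil =>
    refine ⟨_, .nil, .nil, le_rfl, List.Subset.refl _, hw, ?_⟩
    intro y hy
    rw [SimpleGraph.Walk.support_nil, List.mem_singleton] at hy
    subst hy
    exact key .nil .nil le_rfl hx0 hx hw
  | @cons u w v h P ih =>
    have hM := vertexWeight_pos (G := G) (J := J) (β := β) hε hε1 hd u
    by_cases h1 : 1 ≤ x * vertexWeight d ε G J β u
    · refine ⟨u, .nil, .nil, Nat.zero_le _, by simp, by rwa [pathWeight_nil], ?_⟩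
      intro y hy
      rw [SimpleGraph.Walk.support_nil, List.mem_singleton] at hy
      subst hy
      exact key .nil .nil (Nat.zero_le _) hx0 hx (by rwa [pathWeight_nil])
    · push Not at h1
      rw [SimpleGraph.Walk.cons_isPath_iff] at hP
      have hll : P.length ≤ (SimpleGraph.Walk.cons h P).length := by simp
      obtain ⟨z, Q, hQ, hQl, hQs, hQw, hQN⟩ := ih hP.1 ((Nat.cast_le.2 hll).trans hlen)
        (by positivity) h1.le (by rwa [pathWeight_cons, ← mul_assoc] at hw)
        (fun R hR hl => key R hR (hl.trans hll))
      have hQp : (SimpleGraph.Walk.cons h Q).IsPath :=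
        (SimpleGraph.Walk.cons_isPath_iff h Q).2 ⟨hQ, fun hu => hP.2 (hQs hu)⟩
      have hQw' : 1 ≤ x * pathWeight d ε G J β (SimpleGraph.Walk.cons h Q) := by
        rwa [pathWeight_cons, ← mul_assoc]
      refine ⟨z, .cons h Q, hQp, by simpa using hQl, ?_, hQw', ?_⟩
      · simp only [SimpleGraph.Walk.support_cons]
        exact List.cons_subset_cons _ hQs
      · intro y hy
        rw [SimpleGraph.Walk.support_cons, List.mem_cons] at hy
        rcases hy with rfl | hy
        · exact key _ hQp (by simpa using hQl) hx0 hx hQw'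
        · exact hQN y hy

lemma exists_heavy_path (hε : 0 < ε) (hε1 : ε < 1) (hd : 4 ≤ d) {v : V}
    (hv : v ∈ nonBlock d ε G J β) :
    ∃ (z : V) (Q : G.Walk v z), Q.IsPath ∧ (Q.length : ℝ) ≤ Real.log (Fintype.card V) ∧
      1 ≤ pathWeight d ε G J β Q ∧ ∀ y ∈ Q.support, y ∈ nonBlock d ε G J β := by
  simp only [nonBlock, Set.mem_ofPred_eq, IsBlockVertex, not_forall, not_lt] at hv
  obtain ⟨w, P, hP, hl, hw⟩ := hv
  obtain ⟨z, Q, hQ, hQl, -, hQw, hQN⟩ := exists_heavy_prefix hε hε1 hd P hP hl one_pos le_rfl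
    (by simpa using hw)
  exact ⟨z, Q, hQ, (Nat.cast_le.2 hQl).trans hl, by simpa using hQw, hQN⟩

open Classical in
lemma le_sum_heavyLog (hε : 0 < ε) (hε1 : ε < 1) (hd : 4 ≤ d) {u v : V} {P : G.Walk u v}
    (hP : P.IsPath) (hw : 1 ≤ pathWeight d ε G J β P) :
    -Real.log (1 - ε / 4) / 2 * P.support.toFinset.card ≤
      ∑ x ∈ P.support.toFinset, heavyLog d ε G J β x := by
  have h1 : pathWeight d ε G J β P = ∏ x ∈ P.support.toFinset, vertexWeight d ε G J β x :=
    (List.prod_toFinset _ hP.support_nodup).symm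
  have h2 : 0 ≤ ∑ x ∈ P.support.toFinset, Real.log (vertexWeight d ε G J β x) := by
    rw [← Real.log_prod fun x _ => (vertexWeight_pos hε hε1 hd x).ne', ← h1]
    exact Real.log_nonneg hw
  have h3 := h2.trans (Finset.sum_le_sum fun x _ =>
    log_vertexWeight_le (G := G) (J := J) (β := β) hε hε1 hd x)
  rw [Finset.sum_sub_distrib, ← Finset.mul_sum, Finset.sum_const, nsmul_eq_mul] at h3
  linarith

/-- No non-block vertex is isolated among the non-block vertices. Hence the singleton blocks
consist of block vertices. -/
lemma exists_adj_nonBlock (hε : 0 < ε) (hε1 : ε < 1) (hd : 4 ≤ d)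
    (hn : 1 ≤ Real.log (Fintype.card V)) {v : V} (hv : v ∈ nonBlock d ε G J β) :
    ∃ w, G.Adj v w ∧ w ∈ nonBlock d ε G J β := by
  classical
  obtain ⟨z, Q, hQ, hQl, hQw, hQN⟩ := exists_heavy_path hε hε1 hd hv
  cases Q with
  | cons h P => exact ⟨_, h, hQN _ (by simp)⟩
  | nil =>
    -- `v` itself is heavy, hence not isolated, and each neighbour `w` has the heavy path `(w, v)`
    rw [pathWeight_nil] at hQw
    have hA : 1 - ε / 2 < aggInfluence G J β v := by
      by_contra! h
      rw [vertexWeight, if_pos h] at hQw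
      linarith
    obtain ⟨w, hw⟩ : ∃ w, G.Adj v w := by
      by_contra! h
      have h0 : aggInfluence G J β v = 0 := by
        refine Finset.sum_eq_zero fun w hw => ?_
        exact absurd (by simpa using hw) (h w)
      linarith
    refine ⟨w, hw, fun hb => ?_⟩
    have h1 := hb v hw.symm.toWalk (by simp [hw.ne.symm]) (by simpa using hn)
    rw [pathWeight_cons, pathWeight_nil, vertexWeight.eq_1 d ε G J β v, if_neg hA.not_ge] at h1
    have h2 := one_sub_le_vertexWeight (G := G) (J := J) (β := β) hε hε1 hd w
    nlinarith [mul_le_mul h2 (show 2 ≤ d * aggInfluence G J β v by nlinarith) (by norm_num)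
      (by linarith)]

open Classical in
/-- If every large set of vertices that spans as many edges as a tree has small average `heavyLog`,
then there is no long geodesic of non-block vertices. -/
lemma no_long_nonBlock_geodesic (hε : 0 < ε) (hε1 : ε < 1) (hd : 4 ≤ d) {U : Set V}
    (hU : nonBlock d ε G J β ⊆ U) {ℓ : ℕ}
    (hW : ∀ W : Finset V, ℓ + 1 ≤ W.card → W.card ≤ (innerEdges G W).card + 1 →
      ∑ x ∈ W, heavyLog d ε G J β x < -Real.log (1 - ε / 4) / 16 * W.card)
    (q : ℕ → V) (hq : ∀ i ≤ ℓ, q i ∈ nonBlock d ε G J β)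
    (hadj : ∀ i < ℓ, G.Adj (q i) (q (i + 1)))
    (hgeo : ∀ i j, i ≤ j → j ≤ ℓ → j - i ≤ (within G U).dist (q i) (q j)) : False := by
  have hδ : 0 < -Real.log (1 - ε / 4) := by
    have := Real.log_neg (show 0 < 1 - ε / 4 by linarith) (by linarith)
    linarith
  refine no_long_geodesic (N := nonBlock d ε G J β) (h := heavyLog d ε G J β)
    (δ := -Real.log (1 - ε / 4) / 2) (heavyLog_nonneg hε1 hd) (by linarith) ?_ ?_ q hq hadj hgeo
  · intro v hv
    obtain ⟨z, Q, hQ, -, hQw, hQN⟩ := exists_heavy_path hε hε1 hd hv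
    have hcard : Q.support.toFinset.card = Q.length + 1 := by
      rw [List.toFinset_card_of_nodup hQ.support_nodup, SimpleGraph.Walk.length_support]
    refine ⟨Q.support.toFinset, by simp, le_sum_heavyLog hε hε1 hd hQ hQw, ?_, ?_⟩
    · intro x hx
      rw [List.mem_toFinset] at hx
      obtain ⟨p, hp⟩ := exists_walk_within (U := U) (Q.takeUntil x hx) fun y hy =>
        hU (hQN y (Q.support_takeUntil_subset_support hx hy))
      refine ⟨p, ?_⟩
      have := Q.length_takeUntil_le_length hx
      omega
    · exact fun W hvW hWc => card_le_innerEdges_union_support Q hvW hWc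
  · intro W h1 h2
    have := hW W h1 h2
    linarith

end NonBlock

/-! ### Geodesics and short cycles -/

section Geodesics

variable {V : Type*} {G : SimpleGraph V}

lemma sub_le_dist_getVert {a b : V} (p : G.Walk a b) (hp : p.length = G.dist a b) {i j : ℕ}
    (hij : i ≤ j) (hj : j ≤ p.length) : j - i ≤ G.dist (p.getVert i) (p.getVert j) := by
  have hr : G.Reachable (p.getVert i) (p.getVert j) :=
    (p.take i).reachable.symm.trans (p.take j).reachable
  obtain ⟨w, hw⟩ := hr.exists_walk_length_eq_dist
  have h := SimpleGraph.dist_le (((p.take i).append w).append (p.drop j))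
  simp only [SimpleGraph.Walk.length_append, SimpleGraph.Walk.take_length,
    SimpleGraph.Walk.drop_length] at h
  omega

lemma mem_of_within_reachable {U : Set V} {a b : V} (h : (within G U).Reachable a b)
    (hab : a ≠ b) : a ∈ U := by
  obtain ⟨p⟩ := h
  cases p with
  | nil => exact absurd rfl hab
  | cons h _ => exact h.2.1

/-- A geodesic from `x₀` to `a` avoids every other vertex that is at least as far from `x₀`. -/
lemma exists_walk_avoiding {H : SimpleGraph V} (hH : H ≤ G) {x₀ a v : V} (ha : H.Reachable x₀ a)
    (hav : a ≠ v) (hd : H.dist x₀ a ≤ H.dist x₀ v) :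
    ∃ p : G.Walk x₀ a, p.length = H.dist x₀ a ∧ v ∉ p.support := by
  classical
  obtain ⟨p, hp⟩ := ha.exists_walk_length_eq_dist
  refine ⟨p.mapLe hH, by simpa using hp, fun hv => ?_⟩
  rw [SimpleGraph.Walk.support_mapLe_eq_support] at hv
  have h1 := SimpleGraph.dist_le (p.takeUntil v hv)
  have h2 := SimpleGraph.Walk.length_takeUntil_lt_length hv hav.symm
  omega

lemma exists_walk_in_cycle {v x y : V} {C : G.Walk v v} (hx : x ∈ C.support)
    (hy : y ∈ C.support) :
    ∃ p : G.Walk x y, p.length ≤ C.length ∧ ∀ z ∈ p.support, z ∈ C.support := by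
  classical
  have hy' : y ∈ (C.rotate x hx).support := (C.mem_support_rotate_iff x hx).2 hy
  refine ⟨(C.rotate x hx).takeUntil y hy', ?_, fun z hz => ?_⟩
  · simpa using (C.rotate x hx).length_takeUntil_le_length hy'
  · exact (C.mem_support_rotate_iff x hx).1
      ((C.rotate x hx).support_takeUntil_subset_support hy' hz)

/-- The vertices within distance `R` of a cycle of length at most `s₀`. -/
def nearCycle (G : SimpleGraph V) (s₀ R : ℕ) : Set V :=
  {u | ∃ (v : V) (C : G.Walk v v), C.IsCycle ∧ C.length ≤ s₀ ∧
    ∃ x ∈ C.support, ∃ p : G.Walk x u, p.length ≤ R}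

lemma support_subset_nearCycle {s₀ R : ℕ} {v : V} {C : G.Walk v v} (hC : C.IsCycle)
    (hs : C.length ≤ s₀) {x u : V} (hx : x ∈ C.support) (p : G.Walk x u) (hp : p.length ≤ R) :
    ∀ y ∈ p.support, y ∈ nearCycle G s₀ R := by
  classical
  intro y hy
  exact ⟨v, C, hC, hs, x, hx, p.takeUntil y hy, (p.length_takeUntil_le_length hy).trans hp⟩

lemma cycle_subset_nearCycle {s₀ R : ℕ} {v : V} {C : G.Walk v v} (hC : C.IsCycle)
    (hs : C.length ≤ s₀) : ∀ y ∈ C.support, y ∈ nearCycle G s₀ R :=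
  fun y hy => ⟨v, C, hC, hs, y, hy, .nil, Nat.zero_le _⟩

end Geodesics

/-! ### The block partition -/

section Blocks

variable {V : Type*} {G : SimpleGraph V}

open Classical in
/-- The structure of one block. Let `U = N ∪ nearCycle G s₀ R`, suppose that `N` contains no
geodesic of `G[U]` of length `ℓ`, and that no set of at most `K` vertices spans more edges than it
has vertices. Then a connected component `B` of `G[U]` has a core `X`, which is the vertex set of
the only short cycle in `B`, or a single vertex if there is none; every vertex outside `X` has only
one neighbour in `B` towards the core, since two approaches would produce another short cycle. -/
lemma exists_core {N : Set V} {s₀ R ℓ K : ℕ} (hℓ : 2 * ℓ + 2 ≤ s₀)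
    (hK : 5 * s₀ + 4 * R + 2 * ℓ + 5 ≤ K)
    (h2 : ∀ W : Finset V, W.card ≤ K → (innerEdges G W).card ≤ W.card)
    (hgeod : ∀ q : ℕ → V, (∀ i ≤ ℓ, q i ∈ N) → (∀ i < ℓ, G.Adj (q i) (q (i + 1))) →
      (∀ i j, i ≤ j → j ≤ ℓ →
        j - i ≤ (within G (N ∪ nearCycle G s₀ R)).dist (q i) (q j)) → False)
    (v₀ : V) {B : Set V} (hB : ∀ w, w ∈ B ↔ (within G (N ∪ nearCycle G s₀ R)).Reachable v₀ w) :
    ∃ (X : Finset V) (ρ : V → ℕ), (∀ x ∈ X, x ∈ B) ∧ (innerEdges G X).card ≤ X.card ∧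
      (∀ x ∈ X, ρ x = 0) ∧
      (∀ v ∈ B, v ∉ X → ∀ a ∈ B, ∀ b ∈ B, G.Adj v a → G.Adj v b →
        (a ∈ X ∨ ρ a ≤ ρ v) → (b ∈ X ∨ ρ b ≤ ρ v) → a = b) ∧
      (∀ w ∉ B, ∀ a ∈ B, ∀ b ∈ B, G.Adj w a → G.Adj w b → a = b) ∧
      (X.card ≤ 1 ∨ X.card ≤ s₀ ∧
        ∀ x ∈ X, ∀ u, (∃ p : G.Walk x u, p.length ≤ R) → u ∈ N ∪ nearCycle G s₀ R) := by
  set U := N ∪ nearCycle G s₀ R with hU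
  set Γ := within G U with hΓ
  have hΓG : Γ ≤ G := within_le U
  by_cases hcase : ∃ u ∈ B, u ∈ nearCycle G s₀ R
  · -- the block contains the short cycle `C`
    obtain ⟨u₀, hu₀, v, C, hC, hCs, x₀, hx₀, p₀, hp₀⟩ := hcase
    have hCU : ∀ y ∈ C.support, y ∈ U := fun y hy =>
      Or.inr (cycle_subset_nearCycle hC hCs y hy)
    have hx₀B : Γ.Reachable v₀ x₀ := by
      obtain ⟨q, -⟩ := exists_walk_within (U := U) p₀ fun y hy =>
        Or.inr (support_subset_nearCycle hC hCs hx₀ p₀ hp₀ y hy)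
      exact ((hB u₀).1 hu₀).trans q.reachable.symm
    have hBx : ∀ w, w ∈ B ↔ Γ.Reachable x₀ w := fun w =>
      (hB w).trans ⟨fun h => hx₀B.symm.trans h, fun h => hx₀B.trans h⟩
    have hCx : ∀ y ∈ C.support, ∃ p : Γ.Walk x₀ y, p.length ≤ s₀ := by
      intro y hy
      obtain ⟨p, hp, hps⟩ := exists_walk_in_cycle hx₀ hy
      obtain ⟨q, hq⟩ := exists_walk_within (U := U) p fun z hz => hCU z (hps z hz)
      exact ⟨q, by omega⟩
    set X := C.support.toFinset with hX
    have hXc : X.card ≤ s₀ := hC.card_support_toFinset.trans_le hCs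
    have hx₀X : x₀ ∈ X := by simpa [hX] using hx₀
    -- bound on the distance from `x₀` within the block: `R + s₀` steps may run near `C`, and the
    -- rest is a geodesic in `N`
    set D := R + s₀ + ℓ + 1 with hD
    have happroach : ∀ v ∉ X, ∀ a, Γ.Reachable x₀ a → a ≠ v → Γ.dist x₀ a ≤ D + R + s₀ →
        (a ∈ X ∨ Γ.dist x₀ a ≤ Γ.dist x₀ v) →
        ∃ p : G.Walk x₀ a, p.length ≤ D + R + s₀ ∧ v ∉ p.support := by
      intro v hv a ha hav hd h
      rcases h with h | h
      · obtain ⟨p, hp, hps⟩ := exists_walk_in_cycle hx₀ (List.mem_toFinset.1 h)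
        exact ⟨p, by omega, fun hvp => hv (List.mem_toFinset.2 (hps v hvp))⟩
      · obtain ⟨p, hp, hvp⟩ := exists_walk_avoiding hΓG ha hav h
        exact ⟨p, by omega, hvp⟩
    have hstar : ∀ v ∉ X, ∀ a b, G.Adj v a → G.Adj v b →
        (∃ p : G.Walk x₀ a, p.length ≤ D + R + s₀ ∧ v ∉ p.support) →
        (∃ p : G.Walk x₀ b, p.length ≤ D + R + s₀ ∧ v ∉ p.support) → a = b := by
      rintro v hv a b hva hvb ⟨p, hp, hvp⟩ ⟨q, hq, hvq⟩
      by_contra hab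
      obtain ⟨W, hW, hWe⟩ := exists_excess_of_two_approaches (card_cycle_le_innerEdges hC) hx₀X hv
        hab hva hvb p q hvp hvq
      change W.card ≤ X.card + p.length + q.length + 3 at hW
      have := h2 W (by omega)
      omega
    -- a cycle that is not far from `C` has the same vertices
    have hcyc : ∀ {u : V} {C' : G.Walk u u}, C'.IsCycle →
        (∀ y ∈ C'.support, Γ.Reachable x₀ y ∧ Γ.dist x₀ y ≤ D + R + s₀) →
        ∀ y ∈ C'.support, y ∈ X := by
      intro u C' hC' hnear
      refine cycle_support_subset_of_height (B := {y | y ∈ C'.support}) (Γ.dist x₀) ?_ hC'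
        fun y hy => hy
      intro v hv hvX a ha b hb hva hvb hav hbv
      exact hstar v hvX a b hva hvb
        (happroach v hvX a (hnear a ha).1 hva.ne.symm (hnear a ha).2 hav)
        (happroach v hvX b (hnear b hb).1 hvb.ne.symm (hnear b hb).2 hbv)
    have hdist : ∀ u ∈ B, Γ.dist x₀ u ≤ D := by
      intro u hu
      by_contra! hlt
      obtain ⟨p, hp⟩ := ((hBx u).1 hu).exists_walk_length_eq_dist
      -- beyond distance `R + s₀` a geodesic from `C` visits no vertex near a short cycle, as that
      -- cycle would be `C` itself
      refine hgeod (fun i => p.getVert (R + s₀ + 1 + i)) ?_ ?_ ?_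
      · intro i hi
        have hgU : p.getVert (R + s₀ + 1 + i) ∈ U :=
          support_subset_of_within (hCU x₀ hx₀) p _ (p.getVert_mem_support _)
        rcases hgU with hg | ⟨v', C', hC', hC's, x', hx', w, hw⟩
        · exact hg
        · exfalso
          obtain ⟨w', hw'⟩ := exists_walk_within (U := U) w fun y hy =>
            Or.inr (support_subset_nearCycle hC' hC's hx' w hw y hy)
          have htake := p.take_length (R + s₀ + 1 + i)
          have hx'X := hcyc hC' (fun y hy => by
            obtain ⟨r, hr, hrs⟩ := exists_walk_in_cycle hx' hy
            obtain ⟨r', hr'⟩ := exists_walk_within (U := U) r fun z hz =>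
              Or.inr (cycle_subset_nearCycle hC' hC's z (hrs z hz))
            have hd := SimpleGraph.dist_le
              (((p.take (R + s₀ + 1 + i)).append w'.reverse).append r')
            refine ⟨(((p.take (R + s₀ + 1 + i)).append w'.reverse).append r').reachable, ?_⟩
            simp only [SimpleGraph.Walk.length_append, SimpleGraph.Walk.length_reverse] at hd
            omega) x' hx'
          obtain ⟨r, hr⟩ := hCx x' (List.mem_toFinset.1 hx'X)
          have hd := SimpleGraph.dist_le (r.append w')
          have hd' := sub_le_dist_getVert p hp (Nat.zero_le (R + s₀ + 1 + i)) (by omega)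
          rw [SimpleGraph.Walk.getVert_zero] at hd'
          simp only [SimpleGraph.Walk.length_append] at hd
          omega
      · intro i hi
        exact hΓG (p.adj_getVert_succ (by omega))
      · intro i j hij hj
        have := sub_le_dist_getVert p hp (i := R + s₀ + 1 + i) (j := R + s₀ + 1 + j)
          (by omega) (by omega)
        have heq : R + s₀ + 1 + j - (R + s₀ + 1 + i) = j - i := by omega
        rwa [heq] at this
    refine ⟨X, fun u => if u ∈ X then 0 else Γ.dist x₀ u, ?_, h2 X (by omega), ?_, ?_, ?_,
      Or.inr ⟨hXc, ?_⟩⟩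
    · intro y hy
      obtain ⟨p, -⟩ := hCx y (List.mem_toFinset.1 hy)
      exact (hBx y).2 p.reachable
    · intro x hx
      simp [hx]
    · intro v hv hvX a ha b hb hva hvb hav hbv
      have haux : ∀ a ∈ B, G.Adj v a →
          (a ∈ X ∨ (if a ∈ X then 0 else Γ.dist x₀ a) ≤ if v ∈ X then 0 else Γ.dist x₀ v) →
          ∃ p : G.Walk x₀ a, p.length ≤ D + R + s₀ ∧ v ∉ p.support := by
        intro a ha hva hav
        refine happroach v hvX a ((hBx a).1 ha) hva.ne.symm ((hdist a ha).trans (by omega)) ?_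
        by_cases haX : a ∈ X
        · exact Or.inl haX
        · simpa [haX, hvX] using hav
      exact hstar v hvX a b hva hvb (haux a ha hva hav) (haux b hb hvb hbv)
    · intro w hw a ha b hb hwa hwb
      have hwX : w ∉ X := fun h => by
        obtain ⟨p, -⟩ := hCx w (List.mem_toFinset.1 h)
        exact hw ((hBx w).2 p.reachable)
      have haux : ∀ a ∈ B, ∃ p : G.Walk x₀ a, p.length ≤ D + R + s₀ ∧ w ∉ p.support := by
        intro a ha
        obtain ⟨p, hp⟩ := ((hBx a).1 ha).exists_walk_length_eq_dist
        refine ⟨p.mapLe hΓG, ?_, fun h => ?_⟩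
        · have := hdist a ha
          rw [SimpleGraph.Walk.length_mapLe]
          omega
        · rw [SimpleGraph.Walk.support_mapLe_eq_support] at h
          exact hw ((hBx w).2 (p.takeUntil w h).reachable)
      exact hstar w hwX a b hwa hwb (haux a ha) (haux b hb)
    · rintro x hx u ⟨p, hp⟩
      exact Or.inr ⟨v, C, hC, hCs, x, List.mem_toFinset.1 hx, p, hp⟩
  · -- the block contains no vertex near a short cycle
    push Not at hcase
    -- all of the block lies in `N`
    have hdist : ∀ u ∈ B, Γ.dist v₀ u ≤ ℓ := by
      intro u hu
      by_contra! hlt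
      have hr := (hB u).1 hu
      have hv₀U : v₀ ∈ U := mem_of_within_reachable hr fun h => by
        rw [h, SimpleGraph.dist_self] at hlt
        omega
      obtain ⟨p, hp⟩ := hr.exists_walk_length_eq_dist
      refine hgeod (fun i => p.getVert i) ?_ ?_ ?_
      · intro i hi
        rcases support_subset_of_within hv₀U p _ (p.getVert_mem_support i) with h | h
        · exact h
        · exact absurd h (hcase _ ((hB _).2 (p.take i).reachable))
      · intro i hi
        exact hΓG (p.adj_getVert_succ (by omega))
      · intro i j hij hj
        exact sub_le_dist_getVert p hp hij (by omega)
    -- two approaches close up to a short cycle through a vertex of the block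
    have hstar : ∀ v, ∀ a ∈ B, ∀ b, G.Adj v a → G.Adj v b →
        (∃ p : G.Walk v₀ a, p.length ≤ ℓ ∧ v ∉ p.support) →
        (∃ p : G.Walk v₀ b, p.length ≤ ℓ ∧ v ∉ p.support) → a = b := by
      rintro v a ha b hva hvb ⟨p, hp, hvp⟩ ⟨q, hq, hvq⟩
      by_contra hab
      obtain ⟨C, hC, hCl, haC⟩ := exists_cycle_of_two_approaches hab hva hvb p q hvp hvq
      exact hcase a ha (cycle_subset_nearCycle hC (by omega) a haC)
    refine ⟨{v₀}, Γ.dist v₀, ?_, ?_, ?_, ?_, ?_, Or.inl (by simp)⟩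
    · intro x hx
      rw [Finset.mem_singleton.1 hx]
      exact (hB v₀).2 SimpleGraph.Reachable.rfl
    · exact h2 _ (by rw [Finset.card_singleton]; omega)
    · intro x hx
      rw [Finset.mem_singleton.1 hx, SimpleGraph.dist_self]
    · intro v hv hvX a ha b hb hva hvb hav hbv
      have haux : ∀ a ∈ B, G.Adj v a → (a ∈ ({v₀} : Finset V) ∨ Γ.dist v₀ a ≤ Γ.dist v₀ v) →
          ∃ p : G.Walk v₀ a, p.length ≤ ℓ ∧ v ∉ p.support := by
        intro a ha hva hav
        have hav : Γ.dist v₀ a ≤ Γ.dist v₀ v := by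
          rcases hav with h | h
          · rw [Finset.mem_singleton.1 h, SimpleGraph.dist_self]
            exact Nat.zero_le _
          · exact h
        obtain ⟨p, hp, hvp⟩ := exists_walk_avoiding hΓG ((hB a).1 ha) hva.ne.symm hav
        exact ⟨p, hp.trans_le (hdist a ha), hvp⟩
      exact hstar v a ha b hva hvb (haux a ha hva hav) (haux b hb hvb hbv)
    · intro w hw a ha b hb hwa hwb
      have haux : ∀ a ∈ B, ∃ p : G.Walk v₀ a, p.length ≤ ℓ ∧ w ∉ p.support := by
        intro a ha
        obtain ⟨p, hp⟩ := ((hB a).1 ha).exists_walk_length_eq_dist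
        refine ⟨p.mapLe hΓG, ?_, fun h => ?_⟩
        · rw [SimpleGraph.Walk.length_mapLe, hp]
          exact hdist a ha
        · rw [SimpleGraph.Walk.support_mapLe_eq_support] at h
          exact hw ((hB w).2 (p.takeUntil w h).reachable)
      exact hstar w a ha b hwa hwb (haux a ha) (haux b hb)

variable [Fintype V] {J : Sym2 V → ℝ} {d ε β : ℝ}

open Classical in
/-- A graph without small dense spots in which heavy vertices are sparse has a block partition: its
blocks are the connected components of the graph induced on the non-block vertices and the vertices
near short cycles, and the remaining vertices as singletons. -/
theorem exists_isBlockPartition (hε : 0 < ε) (hε1 : ε < 1) (hd : 4 ≤ d)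
    (hn : 1 ≤ Real.log (Fintype.card V)) {s₀ R ℓ K : ℕ} (hR : Real.log d ^ 5 ≤ R)
    (hs₀ : (s₀ : ℝ) ≤ 4 * (Real.log (Fintype.card V) / Real.log d ^ 4)) (hℓ : 2 * ℓ + 2 ≤ s₀)
    (hK : 5 * s₀ + 4 * R + 2 * ℓ + 5 ≤ K)
    (h2 : ∀ W : Finset V, W.card ≤ K → (innerEdges G W).card ≤ W.card)
    (h3 : ∀ W : Finset V, ℓ + 1 ≤ W.card → W.card ≤ (innerEdges G W).card + 1 →
      ∑ x ∈ W, heavyLog d ε G J β x < -Real.log (1 - ε / 4) / 16 * W.card) :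
    ∃ 𝓑 : Set (Set V), IsBlockPartition d ε G J β 𝓑 := by
  set N := nonBlock d ε G J β with hN
  set U := N ∪ nearCycle G s₀ R with hU
  set Γ := within G U with hΓ
  have hΓG : Γ ≤ G := within_le U
  have hcore := fun v₀ (B : Set V) hB => exists_core (N := N) (B := B) hℓ hK h2
    (fun q hq hadj hgeo => no_long_nonBlock_geodesic hε hε1 hd (U := U)
      Set.subset_union_left h3 q hq hadj hgeo) v₀ hB
  have hclass : ∀ B ∈ Γ.reachableSetoid.classes, ∃ v₀, ∀ w, w ∈ B ↔ Γ.Reachable v₀ w := by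
    rintro B ⟨v₀, rfl⟩
    exact ⟨v₀, fun w => ⟨fun h => SimpleGraph.Reachable.symm h, fun h =>
      SimpleGraph.Reachable.symm h⟩⟩
  have hreach : ∀ B ∈ Γ.reachableSetoid.classes, ∀ a ∈ B, ∀ w, w ∈ B ↔ Γ.Reachable a w := by
    intro B hB a ha w
    obtain ⟨v₀, h⟩ := hclass B hB
    rw [h] at ha ⊢
    exact ⟨fun h => ha.symm.trans h, fun h => ha.trans h⟩
  have hBU : ∀ B ∈ Γ.reachableSetoid.classes, B.Nontrivial → ∀ a ∈ B, a ∈ U := by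
    intro B hB hnt a ha
    obtain ⟨b, hb, hab⟩ := hnt.exists_ne a
    exact mem_of_within_reachable ((hreach B hB a ha b).1 hb) hab.symm
  have hbdry : ∀ B ∈ Γ.reachableSetoid.classes, B.Nontrivial → ∀ w ∈ outerBoundary G B,
      w ∉ U := by
    rintro B hB hnt w ⟨hw, y, hy, hwy⟩ hwU
    refine hw ((hreach B hB y hy w).2 ?_)
    have h : Γ.Adj y w := ⟨hwy.symm, hBU B hB hnt y hy, hwU⟩
    exact h.reachable
  -- a cycle inside a block is contained in the core of the block, which is then a short cycle
  have hcycle : ∀ B ∈ Γ.reachableSetoid.classes, ∀ (v : V) (C : G.Walk v v), C.IsCycle →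
      (∀ x ∈ C.support, x ∈ B) → C.length ≤ s₀ ∧
        ∀ x ∈ C.support, ∀ u, (∃ p : G.Walk x u, p.length ≤ R) → u ∈ U := by
    intro B hB v C hC hCB
    obtain ⟨v₀, hv₀⟩ := hclass B hB
    obtain ⟨X, ρ, -, -, -, huniq, -, hX⟩ := hcore v₀ B hv₀
    have hCX := cycle_support_subset_of_height ρ
      (B := B) (X := (X : Set V)) (by simpa using huniq) hC hCB
    have hcard : C.length ≤ X.card := by
      rw [← hC.card_support_toFinset]
      exact Finset.card_le_card fun x hx => hCX x (List.mem_toFinset.1 hx)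
    rcases hX with hX | ⟨hX, hXR⟩
    · have := hC.three_le_length
      omega
    · exact ⟨hcard.trans hX, fun x hx => hXR x (hCX x hx)⟩
  refine ⟨Γ.reachableSetoid.classes, Setoid.isPartition_classes _, ?_, ?_, ?_, ?_, ?_, ?_⟩
  · intro B hB
    obtain ⟨v₀, hv₀⟩ := hclass B hB
    obtain ⟨X, ρ, hXB, hXe, hρ, huniq, -, -⟩ := hcore v₀ B hv₀
    refine isTreePlusEdge_of_card ?_ ?_
    · have hv₀B : v₀ ∈ B := (hv₀ v₀).2 SimpleGraph.Reachable.rfl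
      rw [SimpleGraph.connected_iff_exists_forall_reachable]
      refine ⟨⟨v₀, hv₀B⟩, ?_⟩
      rintro ⟨w, hw⟩
      obtain ⟨p⟩ := (hv₀ w).1 hw
      have hp : ∀ y ∈ (p.mapLe hΓG).support, y ∈ B := fun y hy => by
        rw [SimpleGraph.Walk.support_mapLe_eq_support] at hy
        exact (hv₀ y).2 (p.takeUntil y hy).reachable
      exact ((p.mapLe hΓG).induce B hp).reachable
    · refine card_innerEdges_le_of_height (X := X) (fun x hx => by simpa using hXB x hx) hXe ρ hρ ?_
      intro v hv hvX a ha b hb hva hvb hav hbv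
      exact huniq v (by simpa using hv) hvX a (by simpa using ha) b (by simpa using hb) hva hvb
        (Or.inr hav) (Or.inr hbv)
  · intro B hB hnt w hw
    by_contra h
    exact hbdry B hB hnt w hw (Or.inl h)
  · rintro B hB hnt w ⟨hw, y, hy, hwy⟩
    obtain ⟨v₀, hv₀⟩ := hclass B hB
    obtain ⟨X, ρ, -, -, -, -, huniq, -⟩ := hcore v₀ B hv₀
    exact ⟨y, ⟨hy, hwy⟩, fun z hz => huniq w hw z hz.1 y hy hz.2 hwy⟩
  · intro B hB _ v C hC hCB
    exact (Nat.cast_le.2 (hcycle B hB v C hC hCB).1).trans hs₀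
  · intro B hB hnt v C hC hCB x hx w hw
    by_contra! hlt
    have hdist : G.dist x w < R := by exact_mod_cast hlt.trans_le hR
    refine hbdry B hB hnt w hw ((hcycle B hB v C hC hCB).2 x hx w ?_)
    obtain ⟨hwB, y, hy, hwy⟩ := hw
    have hr : G.Reachable x w :=
      ((((hreach B hB x (hCB x hx) y).1 hy)).mono hΓG).trans hwy.symm.reachable
    obtain ⟨p, hp⟩ := hr.exists_walk_length_eq_dist
    exact ⟨p, hp.le.trans hdist.le⟩
  · intro v hv
    by_contra h
    obtain ⟨w, hvw, hw⟩ := exists_adj_nonBlock hε hε1 hd hn (show v ∈ N from h)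
    have hadj : Γ.Adj v w := ⟨hvw, Or.inl h, Or.inl hw⟩
    have : w ∈ ({v} : Set V) := (hreach {v} hv v rfl w).2 hadj.reachable
    exact hvw.ne.symm this

end Blocks

/-! ### Gaussian estimates -/

section Gaussian

lemma integral_abs_gaussianReal : ∫ x, |x| ∂gaussianReal 0 1 = Real.sqrt (2 / Real.pi) := by
  rw [integral_gaussianReal_eq_integral_smul one_ne_zero]
  have h1 : ∀ x : ℝ, gaussianPDFReal 0 1 x • |x| =
      (fun y => (Real.sqrt (2 * Real.pi))⁻¹ * (y * Real.exp (-(1 / 2) * y ^ 2))) |x| := by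
    intro x
    simp only [gaussianPDFReal, NNReal.coe_one, mul_one, sub_zero, smul_eq_mul, sq_abs]
    rw [show -x ^ 2 / 2 = -(1 / 2) * x ^ 2 by ring]
    ring
  simp_rw [h1]
  rw [integral_comp_abs (f := fun y => (Real.sqrt (2 * Real.pi))⁻¹ *
    (y * Real.exp (-(1 / 2) * y ^ 2))), integral_const_mul]
  have h2 := integral_rpow_mul_exp_neg_mul_rpow (p := 2) (q := 1) (b := 1 / 2) (by norm_num)
    (by norm_num) (by norm_num)
  have h3 : ∫ x in Set.Ioi (0 : ℝ), x * Real.exp (-(1 / 2) * x ^ 2) = 1 := by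
    have h4 : (1 / 2 : ℝ) ^ (-(1 + 1) / 2 : ℝ) * (1 / 2) * Real.Gamma ((1 + 1) / 2) = 1 := by
      norm_num [Real.Gamma_one, Real.rpow_neg_one]
    refine Eq.trans ?_ (h2.trans h4)
    refine setIntegral_congr_fun measurableSet_Ioi fun x _ => ?_
    simp only [Real.rpow_one, Real.rpow_ofNat]
  rw [h3, mul_one, Real.sqrt_div (by norm_num), Real.sqrt_mul (by norm_num), mul_inv]
  have : Real.sqrt 2 ≠ 0 := by positivity
  have h4 : Real.sqrt 2 * Real.sqrt 2 = 2 := Real.mul_self_sqrt (by norm_num)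
  have : Real.sqrt Real.pi ≠ 0 := by positivity
  field_simp
  nlinarith

lemma integrable_exp_mul_abs_gaussianReal (s : ℝ) :
    Integrable (fun x => Real.exp (s * |x|)) (gaussianReal 0 1) := by
  refine ((integrable_exp_mul_gaussianReal (μ := 0) (v := 1) s).add
    (integrable_exp_mul_gaussianReal (μ := 0) (v := 1) (-s))).mono' (by fun_prop) ?_
  filter_upwards with x
  rw [Real.norm_of_nonneg (Real.exp_pos _).le]
  rcases abs_cases x with ⟨h, -⟩ | ⟨h, -⟩
  · simp only [h, Pi.add_apply]
    exact le_add_of_nonneg_right (Real.exp_pos _).le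
  · simp only [h, Pi.add_apply]
    rw [show s * -x = -s * x by ring]
    exact le_add_of_nonneg_left (Real.exp_pos _).le

lemma integral_exp_mul_abs_gaussianReal_le (s : ℝ) :
    ∫ x, Real.exp (s * |x|) ∂gaussianReal 0 1 ≤ 2 * Real.exp (s ^ 2 / 2) := by
  have hmgf : ∀ t : ℝ, ∫ x, Real.exp (t * x) ∂gaussianReal 0 1 = Real.exp (t ^ 2 / 2) := by
    intro t
    have := congrFun (mgf_id_gaussianReal (μ := 0) (v := 1)) t
    simpa [mgf] using this
  calc ∫ x, Real.exp (s * |x|) ∂gaussianReal 0 1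
      ≤ ∫ x, (Real.exp (s * x) + Real.exp (-s * x)) ∂gaussianReal 0 1 := by
        refine integral_mono (integrable_exp_mul_abs_gaussianReal s)
          ((integrable_exp_mul_gaussianReal s).add (integrable_exp_mul_gaussianReal (-s))) ?_
        intro x
        rcases abs_cases x with ⟨h, -⟩ | ⟨h, -⟩
        · simp only [h]
          exact le_add_of_nonneg_right (Real.exp_pos _).le
        · simp only [h]
          rw [show s * -x = -s * x by ring]
          exact le_add_of_nonneg_left (Real.exp_pos _).le
    _ = 2 * Real.exp (s ^ 2 / 2) := by
        rw [integral_add (integrable_exp_mul_gaussianReal s)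
          (integrable_exp_mul_gaussianReal (-s)), hmgf, hmgf]
        rw [neg_sq]; ring

lemma integrable_abs_gaussianReal : Integrable (fun x : ℝ => |x|) (gaussianReal 0 1) :=
  ((memLp_id_gaussianReal 1).integrable (by simp)).abs

/-- Second-order bound for the moment generating function of `|x|`; the linear coefficient is the
first absolute moment. -/
lemma integral_exp_mul_abs_gaussianReal_le_quadratic {s : ℝ} (hs0 : 0 ≤ s) (hs : s ≤ 1) :
    ∫ x, Real.exp (s * |x|) ∂gaussianReal 0 1 ≤ 1 + s * Real.sqrt (2 / Real.pi) + 30 * s ^ 2 := by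
  have hpt : ∀ x : ℝ, Real.exp (s * |x|) ≤ 1 + s * |x| + 2 * s ^ 2 * Real.exp (2 * |x|) := by
    intro x
    have h0 : 0 ≤ |x| := abs_nonneg x
    -- `exp u ≤ 1 + u + u² exp u`, from `1 - u ≤ exp (-u)`
    have h1 : Real.exp (s * |x|) ≤ 1 + s * |x| + (s * |x|) ^ 2 * Real.exp (s * |x|) := by
      set u := s * |x|
      have h0' : 0 ≤ u := by positivity
      have h2 : 1 - u ≤ Real.exp (-u) := by linarith [Real.add_one_le_exp (-u)]
      have h3 : Real.exp (-u) * Real.exp u = 1 := by rw [← Real.exp_add]; simp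
      have h4 : (1 - u) * Real.exp u ≤ 1 := by
        exact (mul_le_mul_of_nonneg_right h2 (Real.exp_pos _).le).trans h3.le
      nlinarith
    have h2 : |x| ^ 2 ≤ 2 * Real.exp |x| := by
      have := Real.quadratic_le_exp_of_nonneg h0
      linarith
    have h3 : Real.exp (s * |x|) ≤ Real.exp |x| := Real.exp_le_exp.2 (by nlinarith)
    have h4 : (s * |x|) ^ 2 * Real.exp (s * |x|) ≤ s ^ 2 * (2 * Real.exp |x|) * Real.exp |x| := by
      rw [mul_pow]
      gcongr
    have h5 : Real.exp (2 * |x|) = Real.exp |x| * Real.exp |x| := by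
      rw [← Real.exp_add]; ring_nf
    rw [h5]
    linarith
  have hI1 : Integrable (fun x : ℝ => 1 + s * |x|) (gaussianReal 0 1) :=
    (integrable_const 1).add (integrable_abs_gaussianReal.const_mul s)
  have hI2 := (integrable_exp_mul_abs_gaussianReal 2).const_mul (2 * s ^ 2)
  have h := integral_mono (integrable_exp_mul_abs_gaussianReal s) (hI1.add hI2) hpt
  simp only [Pi.add_apply] at h
  rw [integral_add hI1 hI2, integral_add (integrable_const 1)
    (integrable_abs_gaussianReal.const_mul s), integral_const_mul, integral_const_mul,
    integral_abs_gaussianReal] at h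
  have h2 := integral_exp_mul_abs_gaussianReal_le 2
  have h3 : Real.exp (2 ^ 2 / 2) ≤ 7.5 := by
    rw [show (2 ^ 2 / 2 : ℝ) = 1 + 1 by norm_num, Real.exp_add]
    nlinarith [Real.exp_one_lt_d9, Real.exp_pos 1]
  simp only [integral_const, probReal_univ, smul_eq_mul, mul_one] at h
  nlinarith [mul_le_mul_of_nonneg_left (h2.trans (mul_le_mul_of_nonneg_left h3 zero_le_two))
    (show 0 ≤ 2 * s ^ 2 by positivity)]

lemma lintegral_ofReal_exp_mul_abs_gaussianReal (s : ℝ) :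
    ∫⁻ x, ENNReal.ofReal (Real.exp (s * |x|)) ∂gaussianReal 0 1 =
      ENNReal.ofReal (∫ x, Real.exp (s * |x|) ∂gaussianReal 0 1) :=
  (ofReal_integral_eq_lintegral_ofReal (integrable_exp_mul_abs_gaussianReal s)
    (Filter.Eventually.of_forall fun _ => (Real.exp_pos _).le)).symm

lemma gaussianReal_abs_lt_le (r : ℝ) :
    gaussianReal 0 1 {x | |x| < r} ≤ ENNReal.ofReal (2 * r) := by
  rw [gaussianReal_apply _ one_ne_zero]
  have hset : {x : ℝ | |x| < r} = Set.Ioo (-r) r := by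
    ext x; simp [abs_lt]
  calc ∫⁻ x in {x | |x| < r}, gaussianPDF 0 1 x ≤ ∫⁻ _ in {x | |x| < r}, 1 := by
        refine lintegral_mono fun x => ?_
        rw [gaussianPDF, ← ENNReal.ofReal_one]
        refine ENNReal.ofReal_le_ofReal ?_
        rw [gaussianPDFReal]
        have h1 : Real.exp (-(x - 0) ^ 2 / (2 * ((1 : NNReal) : ℝ))) ≤ 1 :=
          Real.exp_le_one_iff.2 (by
            have := sq_nonneg (x - 0)
            simp only [NNReal.coe_one, mul_one]
            linarith)
        have h2 : (Real.sqrt (2 * Real.pi * ((1 : NNReal) : ℝ)))⁻¹ ≤ 1 := by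
          refine inv_le_one_of_one_le₀ (Real.one_le_sqrt.2 ?_)
          have := Real.pi_gt_three
          simp only [NNReal.coe_one, mul_one]
          linarith
        exact mul_le_one₀ h2 (Real.exp_pos _).le h1
    _ = ENNReal.ofReal (2 * r) := by
        rw [setLIntegral_const, one_mul, hset, Real.volume_Ioo]
        ring_nf

lemma gaussianReal_lt_abs_le {r : ℝ} (hr : 0 ≤ r) :
    gaussianReal 0 1 {x | r < |x|} ≤ ENNReal.ofReal (2 * Real.exp (-(r ^ 2 / 2))) := by
  have h := mul_meas_ge_le_lintegral₀ (μ := gaussianReal 0 1)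
    (f := fun x => ENNReal.ofReal (Real.exp (r * |x|))) (by fun_prop)
    (ENNReal.ofReal (Real.exp (r ^ 2)))
  rw [lintegral_ofReal_exp_mul_abs_gaussianReal] at h
  have h1 := ENNReal.ofReal_le_ofReal (integral_exp_mul_abs_gaussianReal_le r)
  have h2 : gaussianReal 0 1 {x | r < |x|} ≤ gaussianReal 0 1
      {x | ENNReal.ofReal (Real.exp (r ^ 2)) ≤ ENNReal.ofReal (Real.exp (r * |x|))} := by
    refine measure_mono fun x hx => ?_
    rw [Set.mem_ofPred_eq] at hx ⊢
    exact ENNReal.ofReal_le_ofReal (Real.exp_le_exp.2 (by nlinarith))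
  have h3 : ENNReal.ofReal (2 * Real.exp (-(r ^ 2 / 2))) =
      ENNReal.ofReal (Real.exp (-r ^ 2)) * ENNReal.ofReal (2 * Real.exp (r ^ 2 / 2)) := by
    rw [← ENNReal.ofReal_mul (Real.exp_pos _).le, mul_left_comm, ← Real.exp_add]
    ring_nf
  rw [h3]
  calc gaussianReal 0 1 {x | r < |x|}
      = ENNReal.ofReal (Real.exp (-r ^ 2)) * (ENNReal.ofReal (Real.exp (r ^ 2)) *
          gaussianReal 0 1 {x | r < |x|}) := by
        rw [← mul_assoc, ← ENNReal.ofReal_mul (Real.exp_pos _).le, ← Real.exp_add]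
        simp
    _ ≤ _ := by
        gcongr
        exact (mul_le_mul_right h2 _).trans (h.trans h1)

end Gaussian

/-! ### Exponential moments of sums over the edges of the random graph -/

section Moments

instance {V : Type*} [Countable V] : MeasurableSingletonClass (SimpleGraph V) where
  measurableSet_singleton G := by
    have h : ({G} : Set (SimpleGraph V)) = SimpleGraph.edgeSet ⁻¹' {G.edgeSet} := by
      ext H
      simp
    rw [h]
    exact SimpleGraph.measurable_edgeSet (measurableSet_singleton _)

variable {V : Type*} [Fintype V]

open Classical in
/-- The unordered pairs of distinct vertices, i.e. the potential edges. -/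
def pairs (V : Type*) [Fintype V] : Finset (Sym2 V) := {e | ¬ e.IsDiag}

open Classical in
lemma mem_pairs {e : Sym2 V} : e ∈ pairs V ↔ ¬ e.IsDiag := by
  rw [pairs, Finset.mem_filter]
  exact and_iff_right (Finset.mem_univ _)

open Classical in
lemma card_pairs : (pairs V).card = (Nat.card V).choose 2 := by
  rw [Nat.card_eq_fintype_card, ← Sym2.card_diagSet_compl, ← Set.toFinset_card]
  congr 1
  ext e
  simp [mem_pairs]

open Classical in
/-- The edge indicators are independent: expectations of products over pairs factorize. -/
lemma lintegral_binomialRandom_prod (p : unitInterval) (a b : Sym2 V → ENNReal) :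
    ∫⁻ G, ∏ e ∈ pairs V, (if e ∈ G.edgeSet then a e else b e)
        ∂SimpleGraph.binomialRandom V p =
      ∏ e ∈ pairs V, ((unitInterval.toNNReal p : ENNReal) * a e +
        (unitInterval.toNNReal (unitInterval.symm p) : ENNReal) * b e) := by
  rw [lintegral_fintype, Finset.prod_add]
  refine Finset.sum_nbij' (fun G => {e ∈ pairs V | e ∈ G.edgeSet})
    (fun t => SimpleGraph.fromEdgeSet (t : Set (Sym2 V))) ?_ ?_ ?_ ?_ ?_
  · intro G _
    exact Finset.mem_powerset.2 (Finset.filter_subset _ _)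
  · intro t _
    exact Finset.mem_univ _
  · intro G _
    refine SimpleGraph.edgeSet_injective ?_
    ext e
    rw [SimpleGraph.edgeSet_fromEdgeSet]
    simp only [Finset.coe_filter, Set.mem_sdiff, Set.mem_ofPred_eq, mem_pairs]
    constructor
    · exact fun h => h.1.2
    · intro h
      have := G.not_isDiag_of_mem_edgeSet h
      exact ⟨⟨this, h⟩, this⟩
  · intro t ht
    rw [Finset.mem_powerset] at ht
    generalize hH : SimpleGraph.fromEdgeSet (t : Set (Sym2 V)) = H
    ext e
    rw [Finset.mem_filter, ← hH, SimpleGraph.edgeSet_fromEdgeSet]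
    simp only [Set.mem_sdiff, Finset.mem_coe, mem_pairs]
    constructor
    · exact fun h => h.2.1
    · intro h
      have := mem_pairs.1 (ht h)
      exact ⟨this, h, this⟩
  · intro G _
    have hcard : G.edgeSet.ncard = ({e ∈ pairs V | e ∈ G.edgeSet} : Finset (Sym2 V)).card := by
      rw [← Set.ncard_coe_finset]
      congr 1
      ext e
      simp only [Finset.coe_filter, Set.mem_ofPred_eq, mem_pairs]
      exact ⟨fun h => ⟨G.not_isDiag_of_mem_edgeSet h, h⟩, fun h => h.2⟩
    have hdiff : pairs V \ {e ∈ pairs V | e ∈ G.edgeSet} = {e ∈ pairs V | e ∉ G.edgeSet} := by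
      ext e
      simp only [Finset.mem_sdiff, Finset.mem_filter]
      tauto
    have hcard' : (Nat.card V).choose 2 - G.edgeSet.ncard =
        (pairs V \ {e ∈ pairs V | e ∈ G.edgeSet}).card := by
      rw [Finset.card_sdiff_of_subset (Finset.filter_subset _ _), card_pairs, hcard]
    rw [SimpleGraph.binomialRandom_singleton, hcard', hcard, Finset.prod_mul_distrib,
      Finset.prod_mul_distrib, Finset.prod_const, Finset.prod_const, Finset.prod_ite, hdiff]
    ring

variable {n : ℕ} {d : ℝ}

open Classical in
lemma lintegral_law_prod (g : Sym2 (Fin n) → ℝ → ENNReal) (hg : ∀ e, Measurable (g e))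
    (b : Sym2 (Fin n) → ENNReal) :
    ∫⁻ x, ∏ e ∈ pairs (Fin n), (if e ∈ x.1.edgeSet then g e (x.2 e) else b e) ∂law n d =
      ∏ e ∈ pairs (Fin n),
        ((unitInterval.toNNReal (Set.projIcc (0 : ℝ) 1 zero_le_one (d / n)) : ENNReal) *
          ∫⁻ t, g e t ∂gaussianReal 0 1 +
        (unitInterval.toNNReal (unitInterval.symm (Set.projIcc (0 : ℝ) 1 zero_le_one (d / n))) :
          ENNReal) * b e) := by
  rw [← lintegral_binomialRandom_prod, law, lintegral_prod]
  · refine lintegral_congr fun G => ?_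
    have hm : ∀ e, Measurable fun t : ℝ => if e ∈ G.edgeSet then g e t else b e := by
      intro e
      split_ifs
      · exact hg e
      · exact measurable_const
    have hind := iIndepFun_pi (μ := fun _ : Sym2 (Fin n) => gaussianReal 0 1)
      (X := fun e t => if e ∈ G.edgeSet then g e t else b e) fun e => (hm e).aemeasurable
    have h := lintegral_prod_eq_prod_lintegral_of_indepFun (pairs (Fin n)) _ hind
      fun e => (hm e).comp (measurable_pi_apply e)
    refine h.trans (Finset.prod_congr rfl fun e _ => ?_)
    rw [(measurePreserving_eval (fun _ : Sym2 (Fin n) => gaussianReal 0 1) e).lintegral_comp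
      (hm e)]
    split_ifs
    · rfl
    · simp
  · refine Measurable.aemeasurable (measurable_from_prod_countable_right fun G => ?_)
    refine Finset.measurable_prod _ fun e _ => ?_
    dsimp only
    split_ifs
    · exact (hg e).comp (measurable_pi_apply e)
    · exact measurable_const

open Classical in
/-- The integrand vanishes unless the random graph contains `F`, and is then the exponential of a
sum over its edges. The factor `2` per edge of `F` bounds the moment of that edge; pairs outside `F`
contribute at most `1 + p * y * m e`, where `p` is the edge probability. -/
lemma lintegral_moment_le (hd : 0 ≤ d) (hdn : d ≤ n) (hn : 0 < n) {F : Finset (Sym2 (Fin n))}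
    (hF : F ⊆ pairs (Fin n)) {m : Sym2 (Fin n) → ℕ} (hm : ∀ e, m e ≤ 2) {X : ℝ → ℝ}
    (hX : Measurable X) {y : ℝ} (hy : 0 ≤ y) (hy' : y ≤ 1 / 2)
    (h1 : ∫⁻ t, ENNReal.ofReal (Real.exp (X t)) ∂gaussianReal 0 1 ≤ ENNReal.ofReal (1 + y))
    (h2 : ∫⁻ t, ENNReal.ofReal (Real.exp (2 * X t)) ∂gaussianReal 0 1 ≤
      ENNReal.ofReal (1 + 2 * y)) :
    ∫⁻ x, ∏ e ∈ pairs (Fin n), (if e ∈ x.1.edgeSet then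
        ENNReal.ofReal (Real.exp (m e * X (x.2 e))) else if e ∈ F then 0 else 1) ∂law n d ≤
      ENNReal.ofReal ((2 * (d / n)) ^ F.card *
        Real.exp (d / n * y * ∑ e ∈ pairs (Fin n), (m e : ℝ))) := by
  set p : ℝ := d / n with hp
  have hn' : (0 : ℝ) < n := Nat.cast_pos.2 hn
  have hp0 : 0 ≤ p := by positivity
  have hp1 : p ≤ 1 := (div_le_one hn').2 hdn
  rw [lintegral_law_prod (fun e t => ENNReal.ofReal (Real.exp (m e * X t)))
    (fun e => by fun_prop) (fun e => if e ∈ F then 0 else 1)]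
  have hpI : (unitInterval.toNNReal (Set.projIcc (0 : ℝ) 1 zero_le_one p) : ENNReal) =
      ENNReal.ofReal p := by
    rw [ENNReal.ofReal, Set.projIcc_of_mem _ ⟨hp0, hp1⟩]
    congr 1
    ext
    simp [hp0]
  have hqI : (unitInterval.toNNReal (unitInterval.symm
      (Set.projIcc (0 : ℝ) 1 zero_le_one p)) : ENNReal) = ENNReal.ofReal (1 - p) := by
    rw [ENNReal.ofReal, Set.projIcc_of_mem _ ⟨hp0, hp1⟩]
    congr 1
    ext
    simp [hp1]
  rw [hpI, hqI]
  have hφ : ∀ e, ∫⁻ t, ENNReal.ofReal (Real.exp (m e * X t)) ∂gaussianReal 0 1 ≤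
      ENNReal.ofReal (1 + m e * y) := by
    intro e
    have := hm e
    interval_cases h : m e
    · simp
    · simpa using h1
    · simpa using h2
  have hfac : ∀ e ∈ pairs (Fin n), ENNReal.ofReal p *
      ∫⁻ t, ENNReal.ofReal (Real.exp (m e * X t)) ∂gaussianReal 0 1 +
        ENNReal.ofReal (1 - p) * (if e ∈ F then 0 else 1) ≤
      ENNReal.ofReal ((if e ∈ F then 2 * p else 1) * Real.exp (p * y * m e)) := by
    intro e _
    have hm2 : (m e : ℝ) ≤ 2 := by exact_mod_cast hm e
    have hexp1 : 1 ≤ Real.exp (p * y * m e) := Real.one_le_exp (by positivity)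
    have hexp2 : 1 + p * y * m e ≤ Real.exp (p * y * m e) := by
      linarith [Real.add_one_le_exp (p * y * m e)]
    have hmy : (m e : ℝ) * y ≤ 1 := by nlinarith [(Nat.cast_nonneg (m e) : (0 : ℝ) ≤ m e)]
    refine (add_le_add_left (mul_le_mul_right (hφ e) _) _).trans ?_
    split_ifs
    · rw [mul_zero, add_zero, ← ENNReal.ofReal_mul hp0]
      refine ENNReal.ofReal_le_ofReal ?_
      have : p * (1 + m e * y) ≤ 2 * p := by nlinarith
      exact this.trans (le_mul_of_one_le_right (by positivity) hexp1)
    · rw [mul_one, one_mul, ← ENNReal.ofReal_mul hp0, ← ENNReal.ofReal_add (by positivity)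
        (by linarith)]
      refine ENNReal.ofReal_le_ofReal (le_trans (le_of_eq ?_) hexp2)
      ring
  refine (Finset.prod_le_prod' hfac).trans ?_
  rw [← ENNReal.ofReal_prod_of_nonneg fun e _ => by split_ifs <;> positivity]
  refine ENNReal.ofReal_le_ofReal (le_of_eq ?_)
  rw [Finset.prod_mul_distrib, ← Real.exp_sum, ← Finset.mul_sum, Finset.prod_ite, Finset.prod_const,
    Finset.prod_const_one, mul_one, Finset.filter_mem_eq_inter, Finset.inter_eq_right.2 hF]

open Classical in
/-- A Chernoff bound: the probability that the random graph contains `F` and that the sum of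
`m e * X (J e)` over its edges is at least `c`. -/
lemma law_le_of_moment (hd : 0 ≤ d) (hdn : d ≤ n) (hn : 0 < n) {F : Finset (Sym2 (Fin n))}
    {m : Sym2 (Fin n) → ℕ} (hm : ∀ e, m e ≤ 2) {X : ℝ → ℝ}
    (hX : Measurable X) {y : ℝ} (hy : 0 ≤ y) (hy' : y ≤ 1 / 2)
    (h1 : ∫⁻ t, ENNReal.ofReal (Real.exp (X t)) ∂gaussianReal 0 1 ≤ ENNReal.ofReal (1 + y))
    (h2 : ∫⁻ t, ENNReal.ofReal (Real.exp (2 * X t)) ∂gaussianReal 0 1 ≤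
      ENNReal.ofReal (1 + 2 * y)) {c : ℝ}
    {T : Set (SimpleGraph (Fin n) × (Sym2 (Fin n) → ℝ))}
    (hT : ∀ x ∈ T, (F : Set (Sym2 (Fin n))) ⊆ x.1.edgeSet ∧
      c ≤ ∑ e ∈ x.1.edgeFinset, m e * X (x.2 e)) :
    law n d T ≤ ENNReal.ofReal (Real.exp (-c) * ((2 * (d / n)) ^ F.card *
        Real.exp (d / n * y * ∑ e ∈ pairs (Fin n), (m e : ℝ)))) := by
  by_cases hF : F ⊆ pairs (Fin n)
  swap
  · have : T = ∅ := by
      refine Set.eq_empty_iff_forall_notMem.2 fun x hx => hF fun e he => ?_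
      exact mem_pairs.2 (x.1.not_isDiag_of_mem_edgeSet ((hT x hx).1 he))
    simp [this]
  set f : SimpleGraph (Fin n) × (Sym2 (Fin n) → ℝ) → ENNReal := fun x =>
    ∏ e ∈ pairs (Fin n), (if e ∈ x.1.edgeSet then
      ENNReal.ofReal (Real.exp (m e * X (x.2 e))) else if e ∈ F then 0 else 1) with hf
  have hfm : Measurable f := by
    refine measurable_from_prod_countable_right fun G => ?_
    refine Finset.measurable_prod _ fun e _ => ?_
    dsimp only
    split_ifs <;> fun_prop
  have hmark := mul_meas_ge_le_lintegral₀ (μ := law n d) hfm.aemeasurable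
    (ENNReal.ofReal (Real.exp c))
  have hsub : T ⊆ {x | ENNReal.ofReal (Real.exp c) ≤ f x} := by
    intro x hx
    obtain ⟨hxF, hxc⟩ := hT x hx
    have hfx : f x = ENNReal.ofReal (Real.exp (∑ e ∈ x.1.edgeFinset, m e * X (x.2 e))) := by
      rw [Real.exp_sum, ENNReal.ofReal_prod_of_nonneg fun _ _ => (Real.exp_pos _).le]
      have hsubE : x.1.edgeFinset ⊆ pairs (Fin n) := fun e he =>
        mem_pairs.2 (x.1.not_isDiag_of_mem_edgeSet (SimpleGraph.mem_edgeFinset.1 he))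
      refine (Finset.prod_subset hsubE ?_).symm.trans ?_
      · intro e _ he
        have he' : e ∉ x.1.edgeSet := fun h => he (SimpleGraph.mem_edgeFinset.2 h)
        have heF : e ∉ F := fun h => he' (hxF h)
        rw [if_neg he', if_neg heF]
      · refine Finset.prod_congr rfl fun e he => ?_
        rw [if_pos (SimpleGraph.mem_edgeFinset.1 he)]
    rw [Set.mem_ofPred_eq, hfx]
    exact ENNReal.ofReal_le_ofReal (Real.exp_le_exp.2 hxc)
  have hint := lintegral_moment_le hd hdn hn hF hm hX hy hy' h1 h2
  calc law n d T = ENNReal.ofReal (Real.exp (-c)) * (ENNReal.ofReal (Real.exp c) * law n d T) := by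
        rw [← mul_assoc, ← ENNReal.ofReal_mul (Real.exp_pos _).le, ← Real.exp_add]
        simp
    _ ≤ _ := by
        rw [ENNReal.ofReal_mul (Real.exp_pos _).le]
        gcongr
        exact (mul_le_mul_right (measure_mono hsub) _).trans (hmark.trans hint)

end Moments

/-! ### Incidences between vertices and edges -/

section Incidence

variable {V : Type*}

open Classical in
/-- The number of endpoints of `e` in `S`. -/
def mult (S : Finset V) (e : Sym2 V) : ℕ := ({u ∈ S | u ∈ e} : Finset V).card

open Classical in
lemma mult_le_two (S : Finset V) (e : Sym2 V) : mult S e ≤ 2 := by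
  induction e with | _ a b =>
  have h : ({u ∈ S | u ∈ s(a, b)} : Finset V) ⊆ {a, b} := fun u hu => by
    simpa using (Finset.mem_filter.1 hu).2
  exact (Finset.card_le_card h).trans Finset.card_le_two

lemma one_le_mult {S : Finset V} {e : Sym2 V} {u : V} (hu : u ∈ S) (hue : u ∈ e) :
    1 ≤ mult S e := by
  classical
  exact Finset.card_pos.2 ⟨u, Finset.mem_filter.2 ⟨hu, hue⟩⟩

lemma sum_mult_mul (S : Finset V) (E : Finset (Sym2 V)) (f : Sym2 V → ℝ) [DecidableEq V] :
    ∑ e ∈ E, mult S e * f e = ∑ u ∈ S, ∑ e ∈ E with u ∈ e, f e := by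
  have h : ∀ e, (mult S e : ℝ) * f e = ∑ u ∈ S, if u ∈ e then f e else 0 := by
    intro e
    rw [← Finset.sum_filter, Finset.sum_const, nsmul_eq_mul, mult]
    congr!
  simp_rw [h]
  rw [Finset.sum_comm]
  exact Finset.sum_congr rfl fun u _ => (Finset.sum_filter _ _).symm

open Classical in
lemma sum_mult_le [Fintype V] (S : Finset V) :
    ∑ e ∈ pairs V, (mult S e : ℝ) ≤ S.card * Fintype.card V := by
  have h := sum_mult_mul S (pairs V) fun _ => 1
  simp only [mul_one] at h
  rw [h, ← nsmul_eq_mul]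
  refine Finset.sum_le_card_nsmul _ _ _ fun u _ => ?_
  rw [Finset.sum_const, nsmul_eq_mul, mul_one, Nat.cast_le]
  have hsub : ({e ∈ pairs V | u ∈ e} : Finset (Sym2 V)) ⊆ Finset.univ.image fun w => s(u, w) := by
    intro e he
    obtain ⟨w, rfl⟩ := (Finset.mem_filter.1 he).2
    exact Finset.mem_image_of_mem _ (Finset.mem_univ _)
  exact (Finset.card_le_card hsub).trans Finset.card_image_le

open Classical in
lemma sum_neighborFinset [Fintype V] (G : SimpleGraph V) (u : V) (f : Sym2 V → ℝ) :
    ∑ w ∈ G.neighborFinset u, f s(u, w) = ∑ e ∈ G.edgeFinset with u ∈ e, f e := by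
  rw [← Finset.sum_image (f := f) (g := fun w => s(u, w))
    fun a _ b _ hab => Sym2.congr_right.1 hab]
  congr 1
  ext e
  simp only [Finset.mem_image, Finset.mem_filter, SimpleGraph.mem_neighborFinset,
    SimpleGraph.mem_edgeFinset]
  constructor
  · rintro ⟨w, hw, rfl⟩
    exact ⟨hw, Sym2.mem_mk_left _ _⟩
  · rintro ⟨he, w, rfl⟩
    exact ⟨w, he, rfl⟩

open Classical in
lemma sum_aggInfluence [Fintype V] (G : SimpleGraph V) (J : Sym2 V → ℝ) (β : ℝ) (S : Finset V) :
    ∑ u ∈ S, aggInfluence G J β u = ∑ e ∈ G.edgeFinset, mult S e * influence β (J e) := by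
  rw [sum_mult_mul S G.edgeFinset fun e => influence β (J e)]
  exact Finset.sum_congr rfl fun u _ => sum_neighborFinset G u fun e => influence β (J e)

open Classical in
lemma sum_degree [Fintype V] (G : SimpleGraph V) (S : Finset V) :
    ∑ u ∈ S, (G.degree u : ℝ) = ∑ e ∈ G.edgeFinset, (mult S e : ℝ) := by
  have h1 := sum_mult_mul S G.edgeFinset fun _ => 1
  simp only [mul_one] at h1
  rw [h1]
  refine Finset.sum_congr rfl fun u _ => ?_
  rw [← sum_neighborFinset G u fun _ => 1]
  simp

/-- The influence of an edge is `|tanh (β x / 2)|`, hence at most `β |x| / 2`. -/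
lemma influence_le {β : ℝ} (hβ : 0 ≤ β) (x : ℝ) : influence β x ≤ β / 2 * |x| := by
  have key : ∀ z : ℝ, 0 ≤ z → Real.exp z - 1 ≤ z / 2 * (1 + Real.exp z) := by
    intro z hz
    -- `(1 - z / 2) exp z ≤ 1 + z / 2`, as the difference is increasing in `z`
    have hmono : MonotoneOn (fun z : ℝ => z / 2 * (1 + Real.exp z) - (Real.exp z - 1))
        (Set.Ici 0) := by
      refine monotoneOn_of_deriv_nonneg (convex_Ici 0) (by fun_prop) (by fun_prop) ?_
      intro w hw
      have hd : HasDerivAt (fun z : ℝ => z / 2 * (1 + Real.exp z) - (Real.exp z - 1))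
          (1 / 2 * (1 + Real.exp w) + w / 2 * Real.exp w - Real.exp w) w := by
        have h1 := ((hasDerivAt_id w).div_const 2).mul ((Real.hasDerivAt_exp w).const_add 1)
        exact h1.sub ((Real.hasDerivAt_exp w).sub_const 1)
      rw [hd.deriv]
      have h1 : (1 - w) * Real.exp w ≤ 1 := by
        have h3 : Real.exp (-w) * Real.exp w = 1 := by rw [← Real.exp_add]; simp
        have h4 : 1 - w ≤ Real.exp (-w) := by linarith [Real.add_one_le_exp (-w)]
        exact (mul_le_mul_of_nonneg_right h4 (Real.exp_pos _).le).trans h3.le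
      linarith
    have := hmono (Set.mem_Ici.2 le_rfl) (Set.mem_Ici.2 hz) hz
    simp only [zero_div, zero_mul, Real.exp_zero, sub_self] at this
    linarith
  have hz : β / 2 * |x| = |β * x| / 2 := by
    rw [abs_mul, abs_of_nonneg hβ]; ring
  rw [influence, hz, div_le_iff₀ (by positivity)]
  generalize β * x = z
  rcases le_total 0 z with h | h
  · rw [abs_of_nonneg h, abs_sub_comm, abs_of_nonneg (by linarith [Real.one_le_exp h])]
    exact key z h
  · have h1 := key (-z) (by linarith)
    rw [abs_of_nonpos h, abs_of_nonneg (by linarith [Real.exp_le_one_iff.2 h])]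
    have h3 : Real.exp (-z) * Real.exp z = 1 := by rw [← Real.exp_add]; simp
    have h4 := mul_le_mul_of_nonneg_right h1 (Real.exp_pos z).le
    nlinarith

end Incidence

/-! ### Union bounds -/

section UnionBound

/-- There are at most `(16 n) ^ k` ways to choose `k` of `n` vertices and at most `k + 1` of the
pairs that they span. -/
lemma choose_mul_choose_le {n k j N : ℕ} (hk : 1 ≤ k) (hj : j ≤ k + 1) (hN : N ≤ k ^ 2) :
    (n.choose k * N.choose j : ℝ) ≤ (16 * n) ^ k := by
  have h1 : (n.choose k : ℝ) ≤ n ^ k / k.factorial := Nat.choose_le_pow_div k n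
  have h2 : (N.choose j : ℝ) ≤ (k ^ 2 : ℝ) ^ j / j.factorial := by
    refine (Nat.choose_le_pow_div j N).trans ?_
    have : (N : ℝ) ≤ (k : ℝ) ^ 2 := by exact_mod_cast hN
    gcongr
  have hk0 : (0 : ℝ) ≤ k := Nat.cast_nonneg k
  have hk1 : (1 : ℝ) ≤ k := by exact_mod_cast hk
  have h3 : (k : ℝ) ^ k / k.factorial ≤ Real.exp k := Real.pow_div_factorial_le_exp _ hk0 _
  have h4 : (k : ℝ) ^ j / j.factorial ≤ Real.exp k := Real.pow_div_factorial_le_exp _ hk0 _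
  have h5 : (k : ℝ) ^ j ≤ k * k ^ k := by
    calc (k : ℝ) ^ j ≤ k ^ (k + 1) := pow_le_pow_right₀ hk1 hj
      _ = k * k ^ k := pow_succ' _ _
  have h6 : (k : ℝ) ≤ 2 ^ k := by exact_mod_cast (Nat.lt_two_pow_self (n := k)).le
  have h7 : Real.exp k * Real.exp k ≤ 8 ^ k := by
    rw [← Real.exp_add, ← two_mul, mul_comm, Real.exp_nat_mul]
    refine pow_le_pow_left₀ (Real.exp_pos _).le ?_ _
    rw [show (2 : ℝ) = 1 + 1 by norm_num, Real.exp_add]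
    nlinarith [Real.exp_one_lt_d9, Real.exp_pos 1]
  calc (n.choose k * N.choose j : ℝ)
      ≤ n ^ k / k.factorial * ((k ^ 2 : ℝ) ^ j / j.factorial) := by gcongr
    _ = n ^ k * ((k : ℝ) ^ j / k.factorial) * ((k : ℝ) ^ j / j.factorial) := by
        rw [← pow_mul, mul_comm 2 j, pow_mul, sq]; ring
    _ ≤ n ^ k * (k * k ^ k / k.factorial) * ((k : ℝ) ^ j / j.factorial) := by gcongr
    _ = n ^ k * k * ((k : ℝ) ^ k / k.factorial * ((k : ℝ) ^ j / j.factorial)) := by ring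
    _ ≤ n ^ k * 2 ^ k * (Real.exp k * Real.exp k) := by gcongr
    _ ≤ n ^ k * 2 ^ k * 8 ^ k := by gcongr
    _ = (16 * n) ^ k := by
        rw [mul_pow, show (16 : ℝ) = 2 * 8 by norm_num, mul_pow]; ring

variable {n : ℕ} {d : ℝ}

open Classical in
/-- The union bound over a set `W` of `k` vertices, `j` of the pairs inside `W`, and a subset `S`
of `W`. -/
lemma law_exists_le {k j : ℕ} (hk : 1 ≤ k) (hj : j ≤ k + 1)
    {T : Finset (Fin n) → Finset (Sym2 (Fin n)) → Finset (Fin n) →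
      Set (SimpleGraph (Fin n) × (Sym2 (Fin n) → ℝ))} {b : ℝ} (hb : 0 ≤ b)
    (hT : ∀ W F S, W.card = k → F.card = j → S ⊆ W → law n d (T W F S) ≤ ENNReal.ofReal b) :
    law n d {x | ∃ W F S, W.card = k ∧ F.card = j ∧ F ⊆ W.sym2 ∧ S ⊆ W ∧ x ∈ T W F S} ≤
      ENNReal.ofReal ((32 * n) ^ k * b) := by
  have hsub : {x | ∃ W F S, W.card = k ∧ F.card = j ∧ F ⊆ W.sym2 ∧ S ⊆ W ∧ x ∈ T W F S} ⊆
      ⋃ W ∈ Finset.powersetCard k Finset.univ, ⋃ F ∈ Finset.powersetCard j W.sym2,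
        ⋃ S ∈ W.powerset, T W F S := by
    rintro x ⟨W, F, S, hW, hF, hFW, hS, hx⟩
    simp only [Set.mem_iUnion]
    exact ⟨W, Finset.mem_powersetCard.2 ⟨Finset.subset_univ _, hW⟩, F,
      Finset.mem_powersetCard.2 ⟨hFW, hF⟩, S, Finset.mem_powerset.2 hS, hx⟩
  have hN : (k + 1).choose 2 ≤ k ^ 2 := by
    rw [Nat.choose_two_right]
    refine Nat.div_le_of_le_mul ?_
    simp only [Nat.add_sub_cancel]
    nlinarith
  calc law n d {x | ∃ W F S, W.card = k ∧ F.card = j ∧ F ⊆ W.sym2 ∧ S ⊆ W ∧ x ∈ T W F S}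
      ≤ ∑ W ∈ Finset.powersetCard k Finset.univ, ∑ F ∈ Finset.powersetCard j W.sym2,
          ∑ S ∈ W.powerset, ENNReal.ofReal b := by
        refine (measure_mono hsub).trans ((measure_biUnion_finset_le _ _).trans ?_)
        refine Finset.sum_le_sum fun W hW => (measure_biUnion_finset_le _ _).trans ?_
        refine Finset.sum_le_sum fun F hF => (measure_biUnion_finset_le _ _).trans ?_
        refine Finset.sum_le_sum fun S hS => hT W F S ?_ ?_ ?_
        · exact (Finset.mem_powersetCard.1 hW).2
        · exact (Finset.mem_powersetCard.1 hF).2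
        · exact Finset.mem_powerset.1 hS
    _ = ∑ W ∈ Finset.powersetCard k (Finset.univ : Finset (Fin n)),
          ENNReal.ofReal (((k + 1).choose 2).choose j * (2 ^ k * b)) := by
        refine Finset.sum_congr rfl fun W hW => ?_
        have hWk := (Finset.mem_powersetCard.1 hW).2
        rw [Finset.sum_const, Finset.sum_const, Finset.card_powersetCard, Finset.card_sym2,
          Finset.card_powerset, hWk, nsmul_eq_mul, nsmul_eq_mul,
          ENNReal.ofReal_mul (Nat.cast_nonneg _), ENNReal.ofReal_mul (by positivity),
          ENNReal.ofReal_natCast, ENNReal.ofReal_pow (by norm_num)]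
        simp
    _ = ENNReal.ofReal ((n.choose k * ((k + 1).choose 2).choose j) * (2 ^ k * b)) := by
        rw [Finset.sum_const, Finset.card_powersetCard, Finset.card_univ, Fintype.card_fin,
          nsmul_eq_mul, mul_assoc, ENNReal.ofReal_mul (Nat.cast_nonneg (n.choose k)),
          ENNReal.ofReal_natCast]
    _ ≤ _ := by
        refine ENNReal.ofReal_le_ofReal ?_
        calc ((n.choose k * ((k + 1).choose 2).choose j) * (2 ^ k * b) : ℝ)
            ≤ (16 * n) ^ k * (2 ^ k * b) := by
              gcongr
              exact choose_mul_choose_le hk hj hN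
          _ = (32 * n) ^ k * b := by
              rw [← mul_assoc, ← mul_pow]; ring

end UnionBound

/-! ### Unlikely events -/

section Events

variable {n : ℕ} {d : ℝ}

open Classical in
lemma exists_subset_innerEdges {V : Type*} {G : SimpleGraph V} {W : Finset V} {j : ℕ}
    (hj : j ≤ (innerEdges G W).card) :
    ∃ F : Finset (Sym2 V), F ⊆ W.sym2 ∧ F.card = j ∧ (F : Set (Sym2 V)) ⊆ G.edgeSet := by
  obtain ⟨F, hF, hFj⟩ := Finset.exists_subset_card_eq hj
  exact ⟨F, hF.trans (innerEdges_subset_sym2 W), hFj, fun e he => (mem_innerEdges.1 (hF he)).2⟩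

/-- Sets that span more edges than they have vertices are unlikely, by the first moment. -/
lemma law_exists_dense_le (hd : 0 ≤ d) (hdn : d ≤ n) (hn : 0 < n) {k : ℕ} (hk : 1 ≤ k) :
    law n d {x | ∃ W : Finset (Fin n), W.card = k ∧ W.card < (innerEdges x.1 W).card} ≤
      ENNReal.ofReal ((64 * d) ^ k * (2 * d / n)) := by
  classical
  have hn' : (0 : ℝ) < n := Nat.cast_pos.2 hn
  have h := law_exists_le (n := n) (d := d) (k := k) (j := k + 1) hk le_rfl
    (T := fun _ F _ => {x | (F : Set (Sym2 (Fin n))) ⊆ x.1.edgeSet})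
    (b := (2 * (d / n)) ^ (k + 1)) (by positivity) (by
      intro W F S _ hF _
      have := law_le_of_moment (n := n) (d := d) hd hdn hn (F := F) (m := fun _ => 0)
        (X := fun _ => 0) (y := 0) (c := 0)
        (T := {x | (F : Set (Sym2 (Fin n))) ⊆ x.1.edgeSet}) (by simp) measurable_const le_rfl
        (by norm_num) (by simp) (by simp) (fun x hx => ⟨hx, by simp⟩)
      simpa [hF] using this)
  refine (measure_mono ?_).trans (h.trans (ENNReal.ofReal_le_ofReal (le_of_eq ?_)))
  · rintro x ⟨W, hWk, hW⟩
    obtain ⟨F, hFW, hF, hFG⟩ := exists_subset_innerEdges (G := x.1) (W := W) (j := k + 1)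
      (by omega)
    exact ⟨W, F, ∅, hWk, hF, hFW, Finset.empty_subset _, hFG⟩
  · rw [pow_succ, ← mul_assoc, ← mul_pow]
    congr 1
    · congr 1
      field_simp
      ring
    · ring

lemma pow_mul_pow_sub_one_le {k : ℕ} (hk : 1 ≤ k) (hd : 1 ≤ d) (hn : 0 < n) :
    (32 * n : ℝ) ^ k * (2 * (d / n)) ^ (k - 1) ≤ n * (64 * d) ^ k := by
  obtain ⟨k, rfl⟩ := Nat.exists_eq_add_of_le' hk
  have hn' : (0 : ℝ) < n := Nat.cast_pos.2 hn
  rw [Nat.add_sub_cancel, pow_succ, mul_right_comm, ← mul_pow, pow_succ]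
  have h : (32 * n * (2 * (d / n)) : ℝ) = 64 * d := by field_simp; norm_num
  rw [h]
  have : 0 < (64 * d) ^ k := by positivity
  nlinarith [mul_pos this hn']

/-- The moment conditions for `s |x|`, where the linear term has the sharp constant. -/
lemma lintegral_exp_linear_le {s y : ℝ} (hs0 : 0 ≤ s) (hs : s ≤ 1 / 2)
    (hy : s * Real.sqrt (2 / Real.pi) + 60 * s ^ 2 ≤ y) :
    ∫⁻ x, ENNReal.ofReal (Real.exp (s * |x|)) ∂gaussianReal 0 1 ≤ ENNReal.ofReal (1 + y) ∧
      ∫⁻ x, ENNReal.ofReal (Real.exp (2 * (s * |x|))) ∂gaussianReal 0 1 ≤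
        ENNReal.ofReal (1 + 2 * y) := by
  constructor
  · rw [lintegral_ofReal_exp_mul_abs_gaussianReal]
    refine ENNReal.ofReal_le_ofReal
      ((integral_exp_mul_abs_gaussianReal_le_quadratic hs0 (by linarith)).trans ?_)
    nlinarith [sq_nonneg s]
  · simp_rw [← mul_assoc]
    rw [lintegral_ofReal_exp_mul_abs_gaussianReal]
    refine ENNReal.ofReal_le_ofReal
      ((integral_exp_mul_abs_gaussianReal_le_quadratic (by linarith) (by linarith)).trans ?_)
    nlinarith [sq_nonneg s]

variable {β ε : ℝ}

/-- Large sets of heavy vertices are unlikely, because the expected aggregate influence of a vertex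
is below the threshold for heaviness. The set `S` of the union bound is the set of heavy vertices of
`W`; their joint aggregate influence has an exponential moment of order `lam`. -/
lemma law_exists_heavy_le (hd : 4 ≤ d) (hdn : d ≤ n) (hn : 0 < n) {k : ℕ} (hk : 1 ≤ k)
    (hβ : 0 ≤ β) (hε : 0 < ε) (hε1 : ε < 1) {t lam c y s : ℝ} (ht : 0 ≤ t)
    (hlam : t ≤ lam * (1 - ε / 2)) (hs : lam * (β / 2) ≤ s) (hs' : s ≤ 1 / 2)
    (hy : s * Real.sqrt (2 / Real.pi) + 60 * s ^ 2 ≤ y) (hy' : y ≤ 1 / 2)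
    (hexp : t * Real.log d - lam * (1 - ε / 2) + d * y ≤ 0) :
    law n d {x | ∃ W : Finset (Fin n), W.card = k ∧ W.card ≤ (innerEdges x.1 W).card + 1 ∧
        c * W.card ≤ ∑ u ∈ W, heavyLog d ε x.1 x.2 β u} ≤
      ENNReal.ofReal (n * (64 * d * Real.exp (-(t * c))) ^ k) := by
  classical
  have hn' : (0 : ℝ) < n := Nat.cast_pos.2 hn
  have ha : 0 < 1 - ε / 2 := by linarith
  have hlam0 : 0 ≤ lam := by
    by_contra! h
    nlinarith
  have hs0 : 0 ≤ s := le_trans (by positivity) hs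
  have hy0 : 0 ≤ y := le_trans (by positivity) hy
  obtain ⟨hX1, hX2⟩ := lintegral_exp_linear_le hs0 hs' hy
  have h := law_exists_le (n := n) (d := d) (k := k) (j := k - 1) hk (by omega)
    (T := fun W F S => {x | (F : Set (Sym2 (Fin n))) ⊆ x.1.edgeSet ∧
      t * c * k - S.card * (t * Real.log d - lam * (1 - ε / 2)) ≤
        ∑ e ∈ x.1.edgeFinset, mult S e * (s * |x.2 e|)})
    (b := Real.exp (-(t * c * k)) * (2 * (d / n)) ^ (k - 1)) (by positivity) (by
      intro W F S _ hF _
      refine (law_le_of_moment (by linarith) hdn hn (F := F) (m := mult S) (mult_le_two S)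
        (X := fun x => s * |x|) (by fun_prop) hy0 hy' hX1 hX2 (fun x hx => hx)).trans ?_
      refine ENNReal.ofReal_le_ofReal ?_
      rw [hF, mul_left_comm, mul_comm _ ((2 * (d / n)) ^ (k - 1)), ← Real.exp_add]
      refine mul_le_mul_of_nonneg_left (Real.exp_le_exp.2 ?_) (by positivity)
      have h1 := sum_mult_le S
      rw [Fintype.card_fin] at h1
      have h2 : d / n * y * ∑ e ∈ pairs (Fin n), (mult S e : ℝ) ≤ S.card * (d * y) := by
        calc d / n * y * ∑ e ∈ pairs (Fin n), (mult S e : ℝ)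
            ≤ d / n * y * (S.card * n) :=
              mul_le_mul_of_nonneg_left h1 (by positivity)
          _ = S.card * (d * y) := by field_simp
      have h3 : (S.card : ℝ) * (t * Real.log d - lam * (1 - ε / 2) + d * y) ≤ 0 :=
        mul_nonpos_of_nonneg_of_nonpos (Nat.cast_nonneg _) hexp
      linarith)
  refine (measure_mono ?_).trans (h.trans (ENNReal.ofReal_le_ofReal ?_))
  · rintro x ⟨W, hWk, hWe, hW⟩
    obtain ⟨F, hFW, hF, hFG⟩ := exists_subset_innerEdges (G := x.1) (W := W) (j := k - 1)
      (by omega)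
    refine ⟨W, F, {u ∈ W | ¬ aggInfluence x.1 x.2 β u ≤ 1 - ε / 2}, hWk, hF, hFW,
      Finset.filter_subset _ _, hFG, ?_⟩
    set S : Finset (Fin n) := {u ∈ W | ¬ aggInfluence x.1 x.2 β u ≤ 1 - ε / 2} with hS
    have hsum : ∑ u ∈ W, heavyLog d ε x.1 x.2 β u =
        ∑ u ∈ S, Real.log (d * aggInfluence x.1 x.2 β u) := by
      rw [hS, Finset.sum_filter]
      refine Finset.sum_congr rfl fun u _ => ?_
      simp only [heavyLog, ite_not]
    have hterm : ∀ u ∈ S, t * Real.log (d * aggInfluence x.1 x.2 β u) ≤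
        (t * Real.log d - lam * (1 - ε / 2)) + lam * aggInfluence x.1 x.2 β u := by
      intro u hu
      have hA : 1 - ε / 2 < aggInfluence x.1 x.2 β u := not_le.1 (Finset.mem_filter.1 hu).2
      generalize aggInfluence x.1 x.2 β u = A at hA
      have hA0 : 0 < A := ha.trans hA
      rw [Real.log_mul (by positivity) hA0.ne']
      have h1 : Real.log (A / (1 - ε / 2)) ≤ A / (1 - ε / 2) - 1 :=
        Real.log_le_sub_one_of_pos (by positivity)
      rw [Real.log_div hA0.ne' ha.ne'] at h1
      have h2 : Real.log (1 - ε / 2) ≤ 0 := Real.log_nonpos ha.le (by linarith)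
      have h3 : t * (A / (1 - ε / 2) - 1) ≤ lam * (A - (1 - ε / 2)) := by
        have h4 : A / (1 - ε / 2) - 1 = (A - (1 - ε / 2)) / (1 - ε / 2) := by
          rw [sub_div, div_self ha.ne']
        rw [h4, mul_div_assoc', div_le_iff₀ ha]
        nlinarith [mul_le_mul_of_nonneg_right hlam (sub_nonneg.2 hA.le)]
      nlinarith [mul_le_mul_of_nonneg_left h1 ht, mul_le_mul_of_nonneg_left h2 ht]
    have h1 : t * c * k ≤ S.card * (t * Real.log d - lam * (1 - ε / 2)) +
        lam * ∑ u ∈ S, aggInfluence x.1 x.2 β u := by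
      calc t * c * k = t * (c * W.card) := by rw [hWk]; ring
        _ ≤ t * ∑ u ∈ S, Real.log (d * aggInfluence x.1 x.2 β u) := by
            rw [← hsum]; exact mul_le_mul_of_nonneg_left hW ht
        _ ≤ ∑ u ∈ S, ((t * Real.log d - lam * (1 - ε / 2)) +
              lam * aggInfluence x.1 x.2 β u) := by
            rw [Finset.mul_sum]; exact Finset.sum_le_sum hterm
        _ = _ := by
            rw [Finset.sum_add_distrib, Finset.sum_const, nsmul_eq_mul, Finset.mul_sum]
    have h2 : lam * ∑ u ∈ S, aggInfluence x.1 x.2 β u ≤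
        ∑ e ∈ x.1.edgeFinset, mult S e * (s * |x.2 e|) := by
      rw [sum_aggInfluence, Finset.mul_sum]
      refine Finset.sum_le_sum fun e _ => ?_
      have h3 : lam * influence β (x.2 e) ≤ s * |x.2 e| := by
        calc lam * influence β (x.2 e) ≤ lam * (β / 2 * |x.2 e|) :=
              mul_le_mul_of_nonneg_left (influence_le hβ _) hlam0
          _ = lam * (β / 2) * |x.2 e| := by ring
          _ ≤ s * |x.2 e| := mul_le_mul_of_nonneg_right hs (abs_nonneg _)
      calc lam * (mult S e * influence β (x.2 e)) = mult S e * (lam * influence β (x.2 e)) := by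
            ring
        _ ≤ mult S e * (s * |x.2 e|) := mul_le_mul_of_nonneg_left h3 (Nat.cast_nonneg _)
    linarith
  · have h1 : Real.exp (-(t * c * k)) = Real.exp (-(t * c)) ^ k := by
      rw [← Real.exp_nat_mul]; ring_nf
    rw [mul_pow (64 * d), h1, mul_left_comm, ← mul_assoc (n : ℝ), mul_comm]
    exact mul_le_mul_of_nonneg_right (pow_mul_pow_sub_one_le hk (by linarith) hn) (by positivity)

open Classical in
/-- The weight `Υ` of a vertex set. -/
def setUpsilon {V : Type*} [Fintype V] (G : SimpleGraph V) (J : Sym2 V → ℝ) (β : ℝ)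
    (W : Finset V) : ℝ :=
  β * (∑ e ∈ G.edgeFinset with ∃ x ∈ W, x ∈ e, |J e|) + ∑ x ∈ W, Real.log (G.degree x)

open Classical in
lemma exists_setUpsilon_eq {V : Type*} [Fintype V] (G : SimpleGraph V) (J : Sym2 V → ℝ) (β : ℝ)
    {u v : V} {P : G.Walk u v} (hP : P.IsPath) :
    ∃ W : Finset V, W.card = P.length + 1 ∧ W.card ≤ (innerEdges G W).card + 1 ∧
      upsilon G J β P = setUpsilon G J β W := by
  refine ⟨P.support.toFinset, ?_, ?_, ?_⟩
  · rw [List.toFinset_card_of_nodup hP.support_nodup, SimpleGraph.Walk.length_support]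
  · have h := card_le_innerEdges_union_support P (W := {u}) (c := 1) (by simp) (by simp)
    rwa [Finset.union_eq_right.2 (by simp)] at h
  · unfold upsilon setUpsilon
    simp only [List.mem_toFinset]

/-- `Υ` is at most a sum over the edges that meet `W`, by `log x ≤ log d + x / d`. -/
lemma setUpsilon_le {V : Type*} [Fintype V] (G : SimpleGraph V) [Fintype G.edgeSet]
    (J : Sym2 V → ℝ) (hβ : 0 ≤ β)
    (hd : 1 ≤ d) (W : Finset V) :
    setUpsilon G J β W ≤
      W.card * Real.log d + ∑ e ∈ G.edgeFinset, mult W e * (β * |J e| + 1 / d) := by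
  classical
  have h1 : ∑ e ∈ G.edgeFinset with ∃ x ∈ W, x ∈ e, |J e| ≤
      ∑ e ∈ G.edgeFinset, mult W e * |J e| := by
    rw [Finset.sum_filter]
    refine Finset.sum_le_sum fun e _ => ?_
    split_ifs with h
    · obtain ⟨u, hu, hue⟩ := h
      have : (1 : ℝ) ≤ mult W e := by exact_mod_cast one_le_mult hu hue
      exact le_mul_of_one_le_left (abs_nonneg _) this
    · positivity
  have h2 : ∑ u ∈ W, Real.log (G.degree u) ≤
      W.card * Real.log d + ∑ e ∈ G.edgeFinset, mult W e * (1 / d) := by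
    calc ∑ u ∈ W, Real.log (G.degree u) ≤ ∑ u ∈ W, (Real.log d + G.degree u * (1 / d)) := by
          refine Finset.sum_le_sum fun u _ => ?_
          rcases Nat.eq_zero_or_pos (G.degree u) with h | h
          · rw [h]
            simpa using Real.log_nonneg hd
          · have hu : (0 : ℝ) < G.degree u := Nat.cast_pos.2 h
            have := Real.log_le_sub_one_of_pos (show 0 < G.degree u * (1 / d) by positivity)
            rw [Real.log_mul hu.ne' (by positivity), one_div, Real.log_inv] at this
            rw [one_div]
            linarith
      _ = _ := by
          rw [Finset.sum_add_distrib, Finset.sum_const, nsmul_eq_mul, ← Finset.sum_mul,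
            ← Finset.sum_mul, sum_degree]
          congr!
  have h3 := mul_le_mul_of_nonneg_left h1 hβ
  have h4 : ∑ e ∈ G.edgeFinset, mult W e * (β * |J e| + 1 / d) =
      β * ∑ e ∈ G.edgeFinset, mult W e * |J e| + ∑ e ∈ G.edgeFinset, mult W e * (1 / d) := by
    rw [Finset.mul_sum, ← Finset.sum_add_distrib]
    exact Finset.sum_congr rfl fun e _ => by ring
  unfold setUpsilon
  rw [h4]
  have h5 : β * (∑ e ∈ G.edgeFinset with ∃ x ∈ W, x ∈ e, |J e|) ≤
    β * ∑ e ∈ G.edgeFinset, mult W e * |J e| := h3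
  have h6 : ∀ a b b' c c' : ℝ, b ≤ b' → c ≤ a + c' → b + c ≤ a + (b' + c') := by
    intros; linarith
  refine h6 _ _ _ _ _ (le_trans (le_of_eq ?_) h5) h2
  congr!

/-- Sets of large weight `Υ` are unlikely. -/
lemma law_exists_setUpsilon_le (hd : 1 ≤ d) (hdn : d ≤ n) (hn : 0 < n) {k : ℕ} (hk : 1 ≤ k)
    (hβ : 0 ≤ β) {t r s y : ℝ} (ht : 0 ≤ t) (hs : t * β ≤ s) (hs' : s ≤ 1 / 2) (hy : 0 ≤ y)
    (hy' : y ≤ 1 / 2)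
    (h1 : Real.exp (t / d) * (1 + s * Real.sqrt (2 / Real.pi) + 30 * s ^ 2) ≤ 1 + y)
    (h2 : Real.exp (2 * (t / d)) * (1 + 2 * s * Real.sqrt (2 / Real.pi) + 120 * s ^ 2) ≤
      1 + 2 * y) :
    law n d {x | ∃ W : Finset (Fin n), W.card = k ∧ W.card ≤ (innerEdges x.1 W).card + 1 ∧
        r < setUpsilon x.1 x.2 β W} ≤
      ENNReal.ofReal (n * (64 * d) ^ k * Real.exp (k * (t * Real.log d + d * y) - t * r)) := by
  classical
  have hn' : (0 : ℝ) < n := Nat.cast_pos.2 hn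
  have hs0 : 0 ≤ s := le_trans (by positivity) hs
  have hsplit : ∀ a b : ℝ, ∫⁻ x, ENNReal.ofReal (Real.exp (a * |x| + b)) ∂gaussianReal 0 1 =
      ENNReal.ofReal (Real.exp b * ∫ x, Real.exp (a * |x|) ∂gaussianReal 0 1) := by
    intro a b
    simp_rw [Real.exp_add, mul_comm _ (Real.exp b), ENNReal.ofReal_mul (Real.exp_pos b).le]
    rw [lintegral_const_mul _ (by fun_prop), lintegral_ofReal_exp_mul_abs_gaussianReal]
  have hX1 : ∫⁻ x, ENNReal.ofReal (Real.exp (s * |x| + t / d)) ∂gaussianReal 0 1 ≤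
      ENNReal.ofReal (1 + y) := by
    rw [hsplit]
    refine ENNReal.ofReal_le_ofReal (le_trans ?_ h1)
    gcongr
    exact integral_exp_mul_abs_gaussianReal_le_quadratic hs0 (by linarith)
  have hX2 : ∫⁻ x, ENNReal.ofReal (Real.exp (2 * (s * |x| + t / d))) ∂gaussianReal 0 1 ≤
      ENNReal.ofReal (1 + 2 * y) := by
    simp_rw [mul_add, ← mul_assoc]
    rw [hsplit]
    refine ENNReal.ofReal_le_ofReal (le_trans ?_ h2)
    gcongr
    refine (integral_exp_mul_abs_gaussianReal_le_quadratic (by linarith) (by linarith)).trans ?_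
    nlinarith
  have h := law_exists_le (n := n) (d := d) (k := k) (j := k - 1) hk (by omega)
    (T := fun W F _ => {x | W.card = k ∧ (F : Set (Sym2 (Fin n))) ⊆ x.1.edgeSet ∧
      t * r - k * (t * Real.log d) ≤
        ∑ e ∈ x.1.edgeFinset, mult W e * (s * |x.2 e| + t / d)})
    (b := Real.exp (k * (t * Real.log d + d * y) - t * r) * (2 * (d / n)) ^ (k - 1))
    (by positivity) (by
      intro W F S hWk hF _
      refine (law_le_of_moment (by linarith) hdn hn (F := F) (m := mult W) (mult_le_two W)
        (X := fun x => s * |x| + t / d) (by fun_prop) hy hy' hX1 hX2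
        (fun x hx => hx.2)).trans ?_
      refine ENNReal.ofReal_le_ofReal ?_
      rw [hF, mul_left_comm, mul_comm _ ((2 * (d / n)) ^ (k - 1)), ← Real.exp_add]
      refine mul_le_mul_of_nonneg_left (Real.exp_le_exp.2 ?_) (by positivity)
      have h1 := sum_mult_le W
      rw [Fintype.card_fin, hWk] at h1
      have h2 : d / n * y * ∑ e ∈ pairs (Fin n), (mult W e : ℝ) ≤ k * (d * y) := by
        calc d / n * y * ∑ e ∈ pairs (Fin n), (mult W e : ℝ)
            ≤ d / n * y * (k * n) :=
              mul_le_mul_of_nonneg_left h1 (by positivity)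
          _ = k * (d * y) := by field_simp
      linarith)
  refine (measure_mono ?_).trans (h.trans (ENNReal.ofReal_le_ofReal ?_))
  · rintro x ⟨W, hWk, hWe, hW⟩
    obtain ⟨F, hFW, hF, hFG⟩ := exists_subset_innerEdges (G := x.1) (W := W) (j := k - 1)
      (by omega)
    refine ⟨W, F, ∅, hWk, hF, hFW, Finset.empty_subset _, hWk, hFG, ?_⟩
    have h1 := setUpsilon_le x.1 x.2 hβ hd W
    rw [hWk] at h1
    have h2 : t * ∑ e ∈ x.1.edgeFinset, mult W e * (β * |x.2 e| + 1 / d) ≤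
        ∑ e ∈ x.1.edgeFinset, mult W e * (s * |x.2 e| + t / d) := by
      rw [Finset.mul_sum]
      refine Finset.sum_le_sum fun e _ => ?_
      have h3 : t * (β * |x.2 e| + 1 / d) ≤ s * |x.2 e| + t / d := by
        have := mul_le_mul_of_nonneg_right hs (abs_nonneg (x.2 e))
        have h4 : t * (1 / d) = t / d := by ring
        nlinarith
      calc t * (mult W e * (β * |x.2 e| + 1 / d)) = mult W e * (t * (β * |x.2 e| + 1 / d)) := by
            ring
        _ ≤ _ := mul_le_mul_of_nonneg_left h3 (Nat.cast_nonneg _)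
    have h3 := mul_le_mul_of_nonneg_left (hW.le.trans h1) ht
    rw [mul_add] at h3
    linarith
  · rw [mul_comm (Real.exp _), ← mul_assoc]
    exact mul_le_mul_of_nonneg_right (pow_mul_pow_sub_one_le hk hd hn) (Real.exp_pos _).le

lemma law_exists_coupling_le {r₁ r₂ : ℝ} (hr₁ : 0 ≤ r₁) (hr₂ : 0 ≤ r₂) (hn : 0 < n) :
    law n d {x | ∃ e, |x.2 e| < r₁ ∨ r₂ < |x.2 e|} ≤
      ENNReal.ofReal (n ^ 2 * (2 * r₁ + 2 * Real.exp (-(r₂ ^ 2 / 2)))) := by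
  classical
  have hone : ∀ e : Sym2 (Fin n), law n d {x | |x.2 e| < r₁ ∨ r₂ < |x.2 e|} ≤
      ENNReal.ofReal (2 * r₁ + 2 * Real.exp (-(r₂ ^ 2 / 2))) := by
    intro e
    set A : Set ℝ := {z | |z| < r₁} ∪ {z | r₂ < |z|} with hA
    have hAm : MeasurableSet A :=
      (measurableSet_lt measurable_norm measurable_const).union
        (measurableSet_lt measurable_const measurable_norm)
    have hset : {x : SimpleGraph (Fin n) × (Sym2 (Fin n) → ℝ) | |x.2 e| < r₁ ∨ r₂ < |x.2 e|} =
        Set.univ ×ˢ (Function.eval e ⁻¹' A) := by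
      ext x
      simp [hA]
    rw [hset, law, Measure.prod_prod, measure_univ, one_mul,
      (measurePreserving_eval (fun _ : Sym2 (Fin n) => gaussianReal 0 1) e).measure_preimage
        hAm.nullMeasurableSet, ENNReal.ofReal_add (by positivity) (by positivity)]
    exact (measure_union_le _ _).trans
      (add_le_add (gaussianReal_abs_lt_le r₁) (gaussianReal_lt_abs_le hr₂))
  have hsub : {x : SimpleGraph (Fin n) × (Sym2 (Fin n) → ℝ) |
      ∃ e, |x.2 e| < r₁ ∨ r₂ < |x.2 e|} ⊆
      ⋃ e ∈ (Finset.univ : Finset (Sym2 (Fin n))), {x | |x.2 e| < r₁ ∨ r₂ < |x.2 e|} := by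
    rintro x ⟨e, he⟩
    simp only [Set.mem_iUnion]
    exact ⟨e, Finset.mem_univ _, he⟩
  refine (measure_mono hsub).trans ((measure_biUnion_finset_le _ _).trans ?_)
  refine (Finset.sum_le_card_nsmul _ _ _ fun e _ => hone e).trans ?_
  have hcard : ((Finset.univ : Finset (Sym2 (Fin n))).card : ℝ) ≤ (n : ℝ) ^ 2 := by
    rw [Finset.card_univ, Sym2.card, Fintype.card_fin]
    have : (n + 1).choose 2 ≤ n ^ 2 := by
      rw [Nat.choose_two_right]
      refine Nat.div_le_of_le_mul ?_
      simp only [Nat.add_sub_cancel]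
      nlinarith
    exact_mod_cast this
  rw [nsmul_eq_mul, ENNReal.ofReal_mul (by positivity), ← ENNReal.ofReal_natCast]
  gcongr

end Events

/-! ### The choice of parameters -/

section Parameters

lemma sqrt_two_pi_le : Real.sqrt (2 * Real.pi) ≤ 2.6 := by
  rw [Real.sqrt_le_left (by norm_num)]
  nlinarith [Real.pi_lt_d2]

lemma sqrt_two_div_pi_le : Real.sqrt (2 / Real.pi) ≤ 1 := by
  have h : 2 / Real.pi ≤ 1 := by
    rw [div_le_one Real.pi_pos]
    linarith [Real.pi_gt_three]
  exact (Real.sqrt_le_sqrt h).trans_eq Real.sqrt_one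

lemma sqrt_two_pi_mul : Real.sqrt (2 * Real.pi) * Real.sqrt (2 / Real.pi) = 2 := by
  rw [← Real.sqrt_mul (by positivity), show 2 * Real.pi * (2 / Real.pi) = 2 ^ 2 by
    field_simp, Real.sqrt_sq (by norm_num)]

variable {n : ℕ} {d ε β D X : ℝ}

/-- The moment conditions for the exponent `κ u √(2π) / 2`, the value of `lam * (β / 2)` at
`lam = κ d` and `β = u * betaC d`. -/
lemma heavy_moment_conditions {κ u : ℝ} (hκ0 : 0 ≤ κ) (hκ1 : κ ≤ 1 / 400) (hu0 : 0 ≤ u)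
    (hu1 : u ≤ 1) :
    κ * u * Real.sqrt (2 * Real.pi) / 2 ≤ 1 / 2 ∧
      κ * u * Real.sqrt (2 * Real.pi) / 2 * Real.sqrt (2 / Real.pi) +
        60 * (κ * u * Real.sqrt (2 * Real.pi) / 2) ^ 2 ≤ κ * u + 96 * κ ^ 2 := by
  have hκu : κ * u ≤ κ := mul_le_of_le_one_right hκ0 hu1
  have hκu0 : 0 ≤ κ * u := mul_nonneg hκ0 hu0
  constructor
  · have := mul_le_mul (hκu.trans hκ1) sqrt_two_pi_le (Real.sqrt_nonneg _) (by norm_num)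
    linarith
  · have h1 : κ * u * Real.sqrt (2 * Real.pi) / 2 * Real.sqrt (2 / Real.pi) = κ * u := by
      calc κ * u * Real.sqrt (2 * Real.pi) / 2 * Real.sqrt (2 / Real.pi)
          = κ * u / 2 * (Real.sqrt (2 * Real.pi) * Real.sqrt (2 / Real.pi)) := by ring
        _ = κ * u := by rw [sqrt_two_pi_mul]; ring
    have h2 : (κ * u * Real.sqrt (2 * Real.pi) / 2) ^ 2 = (κ * u) ^ 2 * (Real.pi / 2) := by
      rw [div_pow, mul_pow, Real.sq_sqrt (by positivity)]; ring
    have h3 : (κ * u) ^ 2 * (Real.pi / 2) ≤ κ ^ 2 * 1.6 := by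
      refine mul_le_mul (pow_le_pow_left₀ hκu0 hκu 2) ?_ (by positivity) (by positivity)
      linarith [Real.pi_lt_d2]
    rw [h1, h2]
    linarith

lemma sixty_four_mul_le_exp (hD : D = Real.log d) (hd : 64 ≤ d) : 64 * d ≤ Real.exp (2 * D) := by
  rw [two_mul, Real.exp_add, hD, Real.exp_log (by linarith)]
  exact mul_le_mul_of_nonneg_right hd (by linarith)

/-- With the constant `1 / 400` the second-order term of the moment generating function is
negligible against the gap `ε / 2` between the mean influence and the threshold for heaviness. -/
lemma law_exists_heavy_le_exp (hε : 0 < ε) (hε1 : ε < 1) (hD : D = Real.log d) (hD20 : 20 ≤ D)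
    (hDd : 1600 * D ^ 6 ≤ d * ε ^ 2) (hcD : 5 ≤ -Real.log (1 - ε / 4) / 16 * D)
    (hd : 64 ≤ d) (hdn : d ≤ n) (hn : 0 < n) (hβ : 0 < β)
    (hβc : β ≤ (1 - ε) * betaC d) (hX : X = Real.log n) {k : ℕ} (hk : X / D ^ 4 ≤ k)
    (hk1 : 1 ≤ k) :
    law n d {x | ∃ W : Finset (Fin n), W.card = k ∧ W.card ≤ (innerEdges x.1 W).card + 1 ∧
        -Real.log (1 - ε / 4) / 16 * W.card ≤ ∑ u ∈ W, heavyLog d ε x.1 x.2 β u} ≤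
      ENNReal.ofReal (Real.exp (-3 * X)) := by
  have hd0 : 0 < d := by linarith
  have hD0 : 0 < D := by linarith
  have hn' : (0 : ℝ) < n := Nat.cast_pos.2 hn
  have hκ1 : ε / 400 ≤ 1 / 400 := by linarith
  obtain ⟨hs, hy⟩ := heavy_moment_conditions (κ := ε / 400) (u := 1 - ε) (by positivity) hκ1
    (by linarith) (by linarith)
  have hdε : d * ε ^ 2 ≤ d * ε := by
    rw [sq, ← mul_assoc]
    exact mul_le_of_le_one_right (by positivity) hε1.le
  have hlam : D ^ 5 ≤ ε / 400 * d * (1 - ε / 2) := by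
    have h1 : D ^ 5 ≤ D ^ 6 := pow_le_pow_right₀ (by linarith) (by norm_num)
    have h2 : (d * ε) * (1 / 2) ≤ (d * ε) * (1 - ε / 2) :=
      mul_le_mul_of_nonneg_left (by linarith) (by positivity)
    have h3 : 0 < D ^ 6 := by positivity
    linarith
  have hsβ : ε / 400 * d * (β / 2) ≤ ε / 400 * (1 - ε) * Real.sqrt (2 * Real.pi) / 2 := by
    have h1 : d * β ≤ (1 - ε) * Real.sqrt (2 * Real.pi) := by
      rw [betaC, ← mul_div_assoc, le_div_iff₀ hd0] at hβc
      linarith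
    have := mul_le_mul_of_nonneg_left h1 (show 0 ≤ ε / 400 / 2 by positivity)
    linarith
  have hy' : ε / 400 * (1 - ε) + 96 * (ε / 400) ^ 2 ≤ 1 / 2 := by
    have h1 : ε / 400 * (1 - ε) ≤ 1 / 400 * 1 :=
      mul_le_mul hκ1 (by linarith) (by linarith) (by norm_num)
    have h2 : (ε / 400) ^ 2 ≤ (1 / 400) ^ 2 := pow_le_pow_left₀ (by positivity) hκ1 2
    linarith
  have hexp : D ^ 5 * Real.log d - ε / 400 * d * (1 - ε / 2) +
      d * (ε / 400 * (1 - ε) + 96 * (ε / 400) ^ 2) ≤ 0 := by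
    rw [← hD]
    -- the gap `ε / 2` and the quadratic term combine to `(1 / 800 - 96 / 160000) * ε ^ 2`
    have h1 : D ^ 5 * D - ε / 400 * d * (1 - ε / 2) +
        d * (ε / 400 * (1 - ε) + 96 * (ε / 400) ^ 2) = D ^ 6 - 13 / 20000 * (d * ε ^ 2) := by ring
    have h2 : 0 < d * ε ^ 2 := by positivity
    rw [h1]
    linarith
  refine (law_exists_heavy_le (n := n) (d := d) (k := k) (β := β) (ε := ε) (by linarith) hdn hn
    hk1 hβ.le hε hε1 (c := -Real.log (1 - ε / 4) / 16) (pow_nonneg hD0.le 5) hlam hsβ hs hy hy'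
    hexp).trans (ENNReal.ofReal_le_ofReal ?_)
  generalize -Real.log (1 - ε / 4) / 16 = c at hcD
  have h64 := sixty_four_mul_le_exp hD hd
  have hq : 64 * d * Real.exp (-(D ^ 5 * c)) ≤ Real.exp (-(4 * D ^ 4)) := by
    calc 64 * d * Real.exp (-(D ^ 5 * c)) ≤ Real.exp (2 * D) * Real.exp (-(D ^ 5 * c)) :=
          mul_le_mul_of_nonneg_right h64 (Real.exp_pos _).le
      _ = Real.exp (2 * D + -(D ^ 5 * c)) := (Real.exp_add _ _).symm
      _ ≤ _ := by
          refine Real.exp_le_exp.2 ?_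
          have h1 : 5 * D ^ 4 ≤ D ^ 5 * c := by
            calc 5 * D ^ 4 ≤ (c * D) * D ^ 4 :=
                  mul_le_mul_of_nonneg_right hcD (pow_nonneg hD0.le 4)
              _ = D ^ 5 * c := by ring
          have h2 : 2 * D ≤ D ^ 4 := by
            have h3 : (2 : ℝ) ≤ D ^ 3 := by linarith [pow_le_pow_left₀ (by norm_num) hD20 3]
            calc 2 * D ≤ D ^ 3 * D := mul_le_mul_of_nonneg_right h3 hD0.le
              _ = D ^ 4 := by ring
          linarith
  calc n * (64 * d * Real.exp (-(D ^ 5 * c))) ^ k ≤ n * Real.exp (-(4 * D ^ 4)) ^ k :=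
        mul_le_mul_of_nonneg_left (pow_le_pow_left₀ (by positivity) hq k) hn'.le
    _ = Real.exp X * Real.exp (k * -(4 * D ^ 4)) := by
        rw [Real.exp_nat_mul, hX, Real.exp_log hn']
    _ ≤ Real.exp (-3 * X) := by
        rw [← Real.exp_add]
        refine Real.exp_le_exp.2 ?_
        have := (div_le_iff₀ (by positivity)).1 hk
        linarith

lemma law_exists_setUpsilon_le_exp (hε : 0 < ε) (hD : D = Real.log d) (hD20 : 20 ≤ D)
    (hDd : 1600 * D ^ 6 ≤ d) (hd : 64 ≤ d) (hdn : d ≤ n) (hn : 0 < n) (hβ : 0 < β)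
    (hβc : β ≤ (1 - ε) * betaC d) (hX : X = Real.log n) {k : ℕ} (hk : k ≤ 2 * (X / D ^ 4))
    (hk1 : 1 ≤ k) :
    law n d {x | ∃ W : Finset (Fin n), W.card = k ∧ W.card ≤ (innerEdges x.1 W).card + 1 ∧
        X / D ^ 2 < setUpsilon x.1 x.2 β W} ≤ ENNReal.ofReal (Real.exp (-2 * X)) := by
  have hd0 : 0 < d := by linarith
  have hD0 : 0 < D := by linarith
  have hn' : (0 : ℝ) < n := Nat.cast_pos.2 hn
  have hX0 : 0 ≤ X := by
    rw [hX]
    exact Real.log_nonneg (by exact_mod_cast hn)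
  set τ := 4 * D ^ 2 / d with hτ
  have hτ0 : 0 ≤ τ := by positivity
  have hτ1 : τ ≤ 1 / 1000 := by
    rw [hτ, div_le_iff₀ hd0]
    have h1 : 0 < D ^ 2 := by positivity
    have h2 : (160000 : ℝ) ≤ D ^ 4 := by
      have := pow_le_pow_left₀ (by norm_num) hD20 4
      linarith
    have h3 : D ^ 6 = D ^ 2 * D ^ 4 := by ring
    nlinarith
  have hexp1 : Real.exp τ ≤ 1 + 2 * τ := by
    have h := Real.abs_exp_sub_one_sub_id_le (x := τ) (by rw [abs_of_nonneg hτ0]; linarith)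
    have := (abs_le.1 h).2
    nlinarith
  have hexp2 : Real.exp (2 * τ) ≤ 1 + 4 * τ := by
    have h := Real.abs_exp_sub_one_sub_id_le (x := 2 * τ)
      (by rw [abs_of_nonneg (by positivity)]; linarith)
    have := (abs_le.1 h).2
    nlinarith
  have hsq := sqrt_two_div_pi_le
  have hsq0 : 0 ≤ Real.sqrt (2 / Real.pi) := Real.sqrt_nonneg _
  have hττ : τ ^ 2 ≤ τ / 1000 := by nlinarith
  have key := law_exists_setUpsilon_le (n := n) (d := d) (k := k) (β := β) (by linarith) hdn hn
    hk1 hβ.le (t := 4 * D ^ 2) (r := X / D ^ 2) (s := 2.6 * τ) (y := 10 * τ) (by positivity) ?_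
    (by linarith) (by linarith) (by linarith) ?_ ?_
  · refine key.trans (ENNReal.ofReal_le_ofReal ?_)
    have h64 := sixty_four_mul_le_exp hD hd
    have hdy : d * (10 * τ) = 40 * D ^ 2 := by rw [hτ]; field_simp; norm_num
    have htr : 4 * D ^ 2 * (X / D ^ 2) = 4 * X := by field_simp
    rw [hdy, htr, ← hD]
    calc n * (64 * d) ^ k * Real.exp (k * (4 * D ^ 2 * D + 40 * D ^ 2) - 4 * X)
        ≤ n * Real.exp (2 * D) ^ k *
          Real.exp (k * (4 * D ^ 2 * D + 40 * D ^ 2) - 4 * X) := by gcongr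
      _ = Real.exp (X + k * (2 * D) + (k * (4 * D ^ 2 * D + 40 * D ^ 2) - 4 * X)) := by
          rw [Real.exp_add, Real.exp_add, Real.exp_nat_mul, hX, Real.exp_log hn']
      _ ≤ Real.exp (-2 * X) := by
          refine Real.exp_le_exp.2 ?_
          have h1 : 2 * D + (4 * D ^ 2 * D + 40 * D ^ 2) ≤ 8 * D ^ 3 := by
            have h2 : D ^ 3 = D * D ^ 2 := by ring
            have h3 : 0 < D ^ 2 := by positivity
            nlinarith
          have h2 : (k : ℝ) * (8 * D ^ 3) ≤ X := by
            calc (k : ℝ) * (8 * D ^ 3) ≤ 2 * (X / D ^ 4) * (8 * D ^ 3) := by gcongr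
              _ = 16 * X / D := by field_simp; ring
              _ ≤ X := by rw [div_le_iff₀ hD0]; nlinarith
          have h3 := mul_le_mul_of_nonneg_left h1 (Nat.cast_nonneg (α := ℝ) k)
          linarith
  · have h1 : d * β ≤ 2.6 := by
      have h2 := sqrt_two_pi_le
      have h3 : 0 ≤ Real.sqrt (2 * Real.pi) := Real.sqrt_nonneg _
      rw [betaC, ← mul_div_assoc, le_div_iff₀ hd0] at hβc
      nlinarith
    calc 4 * D ^ 2 * β = τ * (d * β) := by rw [hτ]; field_simp
      _ ≤ τ * 2.6 := by gcongr
      _ = 2.6 * τ := mul_comm _ _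
  · have h1 : 2.6 * τ * Real.sqrt (2 / Real.pi) ≤ 2.6 * τ :=
      mul_le_of_le_one_right (by positivity) hsq
    calc Real.exp τ * (1 + 2.6 * τ * Real.sqrt (2 / Real.pi) + 30 * (2.6 * τ) ^ 2)
        ≤ (1 + 2 * τ) * (1 + 3 * τ) := by
          refine mul_le_mul hexp1 ?_ (by positivity) (by positivity)
          nlinarith
      _ ≤ 1 + 10 * τ := by nlinarith
  · have h1 : 2 * (2.6 * τ) * Real.sqrt (2 / Real.pi) ≤ 2 * (2.6 * τ) :=
      mul_le_of_le_one_right (by positivity) hsq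
    calc Real.exp (2 * τ) * (1 + 2 * (2.6 * τ) * Real.sqrt (2 / Real.pi) + 120 * (2.6 * τ) ^ 2)
        ≤ (1 + 4 * τ) * (1 + 7 * τ) := by
          refine mul_le_mul hexp2 ?_ (by positivity) (by positivity)
          nlinarith
      _ ≤ 1 + 2 * (10 * τ) := by nlinarith

lemma law_exists_dense_le_exp (hD : D = Real.log d) (hD20 : 20 ≤ D)
    (hd : 64 ≤ d) (hdn : d ≤ n) (hn : 0 < n) (hX : X = Real.log n) {K k : ℕ}
    (hK : K ≤ 24 * (X / D ^ 4)) (hkK : k ≤ K) (hk1 : 1 ≤ k) :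
    law n d {x | ∃ W : Finset (Fin n), W.card = k ∧ W.card < (innerEdges x.1 W).card} ≤
      ENNReal.ofReal (2 * d * Real.exp (-(7 / 8) * X)) := by
  have hd0 : 0 < d := by linarith
  have hD0 : 0 < D := by linarith
  have hn' : (0 : ℝ) < n := Nat.cast_pos.2 hn
  have hX0 : 0 ≤ X := by
    rw [hX]
    exact Real.log_nonneg (by exact_mod_cast hn)
  refine (law_exists_dense_le (by linarith) hdn hn hk1).trans (ENNReal.ofReal_le_ofReal ?_)
  have h64 := sixty_four_mul_le_exp hD hd
  have h1 : (64 * d) ^ k ≤ Real.exp (X / 8) := by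
    calc (64 * d) ^ k ≤ Real.exp (2 * D) ^ k := by gcongr
      _ = Real.exp (k * (2 * D)) := (Real.exp_nat_mul _ _).symm
      _ ≤ _ := by
          refine Real.exp_le_exp.2 ?_
          have h2 : (k : ℝ) ≤ 24 * (X / D ^ 4) := (Nat.cast_le.2 hkK).trans hK
          have h3 : (8000 : ℝ) ≤ D ^ 3 := by
            have := pow_le_pow_left₀ (by norm_num) hD20 3
            linarith
          calc (k : ℝ) * (2 * D) ≤ 24 * (X / D ^ 4) * (2 * D) := by gcongr
            _ = 48 * X / D ^ 3 := by field_simp; ring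
            _ ≤ X / 8 := by
                rw [div_le_iff₀ (by positivity)]
                nlinarith
  have h2 : 2 * d / n = 2 * d * Real.exp (-X) := by
    rw [Real.exp_neg, hX, Real.exp_log hn', div_eq_mul_inv]
  rw [h2, mul_left_comm]
  have h3 : (64 * d) ^ k * Real.exp (-X) ≤ Real.exp (-(7 / 8) * X) := by
    calc (64 * d) ^ k * Real.exp (-X) ≤ Real.exp (X / 8) * Real.exp (-X) := by gcongr
      _ = Real.exp (-(7 / 8) * X) := by rw [← Real.exp_add]; ring_nf
  exact mul_le_mul_of_nonneg_left h3 (by positivity)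

lemma law_exists_coupling_le_exp (hn : 0 < n) (hX : X = Real.log n) :
    law n d {x | ∃ e, |x.2 e| < (n : ℝ) ^ (-(7 / 3) : ℝ) ∨ 10 * Real.sqrt X < |x.2 e|} ≤
      ENNReal.ofReal (4 * Real.exp (-(1 / 3) * X)) := by
  have hn' : (0 : ℝ) < n := Nat.cast_pos.2 hn
  have hX0 : 0 ≤ X := by
    rw [hX]
    exact Real.log_nonneg (by exact_mod_cast hn)
  refine (law_exists_coupling_le (by positivity) (by positivity) hn).trans
    (ENNReal.ofReal_le_ofReal ?_)
  have h1 : (n : ℝ) ^ (-(7 / 3) : ℝ) = Real.exp (-(7 / 3) * X) := by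
    rw [Real.rpow_def_of_pos hn', hX, mul_comm]
  have h2 : (n : ℝ) ^ 2 = Real.exp (2 * X) := by
    rw [two_mul, Real.exp_add, hX, Real.exp_log hn', sq]
  have h3 : (10 * Real.sqrt X) ^ 2 / 2 = 50 * X := by
    rw [mul_pow, Real.sq_sqrt hX0]; ring
  rw [h1, h2, h3, mul_add, mul_left_comm, mul_left_comm (Real.exp (2 * X)), ← Real.exp_add,
    ← Real.exp_add]
  have h4 : Real.exp (2 * X + -(7 / 3) * X) = Real.exp (-(1 / 3) * X) := by ring_nf
  have h5 : Real.exp (2 * X + -(50 * X)) ≤ Real.exp (-(1 / 3) * X) :=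
    Real.exp_le_exp.2 (by linarith)
  linarith

end Parameters

/-! ### The class `𝒢(d, ε)` has high probability -/

section Main

variable {n : ℕ} {d ε β D X : ℝ}

open Classical in
/-- Outside the unlikely events the triplet belongs to the class. -/
lemma memClass_of_not_bad (hε : 0 < ε) (hε1 : ε < 1) (hd : 4 ≤ d) (hD : D = Real.log d)
    (hX : X = Real.log n) (hX1 : 1 ≤ X) {s₀ R ℓ K : ℕ} (hR : D ^ 5 ≤ R)
    (hs₀ : (s₀ : ℝ) ≤ 4 * (X / D ^ 4)) (hℓ : ℓ = ⌊X / D ^ 4⌋₊) (hℓs : 2 * ℓ + 2 ≤ s₀)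
    (hK : 5 * s₀ + 4 * R + 2 * ℓ + 5 ≤ K)
    {x : SimpleGraph (Fin n) × (Sym2 (Fin n) → ℝ)}
    (h2 : ∀ k ∈ Finset.Icc 1 K,
      ¬ ∃ W : Finset (Fin n), W.card = k ∧ W.card < (innerEdges x.1 W).card)
    (h3 : ∀ k ∈ Finset.Icc (ℓ + 1) n,
      ¬ ∃ W : Finset (Fin n), W.card = k ∧ W.card ≤ (innerEdges x.1 W).card + 1 ∧
        -Real.log (1 - ε / 4) / 16 * W.card ≤ ∑ u ∈ W, heavyLog d ε x.1 x.2 β u)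
    (h4 : ∀ k ∈ Finset.Icc 1 (ℓ + 1),
      ¬ ∃ W : Finset (Fin n), W.card = k ∧ W.card ≤ (innerEdges x.1 W).card + 1 ∧
        X / D ^ 2 < setUpsilon x.1 x.2 β W)
    (h5 : ¬ ∃ e, |x.2 e| < (n : ℝ) ^ (-(7 / 3) : ℝ) ∨ 10 * Real.sqrt X < |x.2 e|) :
    MemClass d ε x.1 x.2 β := by
  subst hD hX
  refine ⟨?_, ?_, ?_⟩
  · refine exists_isBlockPartition (s₀ := s₀) (R := R) (ℓ := ℓ) (K := K) hε hε1 hd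
      (by rwa [Fintype.card_fin]) hR (by rwa [Fintype.card_fin]) hℓs hK ?_ ?_
    · intro W hW
      by_contra! hlt
      rcases Nat.eq_zero_or_pos W.card with h0 | hpos
      · rw [Finset.card_eq_zero] at h0
        subst h0
        have h : (innerEdges x.1 ∅).card ≤ (∅ : Finset (Fin n)).sym2.card :=
          Finset.card_le_card (innerEdges_subset_sym2 ∅)
        simp only [Finset.sym2_empty, Finset.card_empty] at h hlt
        omega
      · exact h2 W.card (Finset.mem_Icc.2 ⟨hpos, hW⟩) ⟨W, rfl, hlt⟩
    · intro W hW hWe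
      by_contra! hle
      have hWn : W.card ≤ n := by simpa using W.card_le_univ
      exact h3 W.card (Finset.mem_Icc.2 ⟨hW, hWn⟩) ⟨W, rfl, hWe, hle⟩
  · intro u v P hP hlen
    rw [Fintype.card_fin] at hlen ⊢
    obtain ⟨W, hWc, hWe, hW⟩ := exists_setUpsilon_eq x.1 x.2 β hP
    rw [hW]
    by_contra! hlt
    have hPℓ : P.length ≤ ℓ := hℓ ▸ Nat.le_floor hlen
    exact h4 _ (Finset.mem_Icc.2 ⟨by omega, by omega⟩) ⟨W, rfl, hWe, hlt⟩
  · intro e _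
    rw [Fintype.card_fin]
    push Not at h5
    exact h5 e

open Classical in
lemma law_not_memClass_le (hε : 0 < ε) (hε1 : ε < 1) (hD : D = Real.log d) (hD20 : 20 ≤ D)
    (hDd : 1600 * D ^ 6 ≤ d * ε ^ 2) (hcD : 5 ≤ -Real.log (1 - ε / 4) / 16 * D)
    (hn : 0 < n) (hβ : 0 < β) (hβc : β ≤ (1 - ε) * betaC d) (hX : X = Real.log n)
    (hDX : D ≤ X) (hX36 : 36 ≤ X) (hdX : 16 * d ≤ Real.exp (X / 8))
    (hL : 2 * D ^ 5 + 8 ≤ X / D ^ 4) :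
    law n d {x | ¬ MemClass d ε x.1 x.2 β} ≤ ENNReal.ofReal (Real.exp (-(1 / 4) * X)) := by
  have hD0 : 0 < D := by linarith
  have hn' : (0 : ℝ) < n := Nat.cast_pos.2 hn
  have hnX : (n : ℝ) = Real.exp X := by rw [hX, Real.exp_log hn']
  have hX0 : 0 ≤ X := by linarith
  have hdpos : 0 < d := by
    by_contra! h
    have : 0 < D ^ 6 := by positivity
    nlinarith [sq_nonneg ε]
  have hDd' : 1600 * D ^ 6 ≤ d :=
    hDd.trans (mul_le_of_le_one_right hdpos.le (pow_le_one₀ hε.le hε1.le))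
  have hd64 : 64 ≤ d := by
    have := pow_le_pow_left₀ (by norm_num) hD20 6
    linarith
  have hdn : d ≤ n := by
    rw [hnX, ← Real.exp_log hdpos, ← hD]
    exact Real.exp_le_exp.2 hDX
  have hD4 : 1 ≤ D ^ 4 := one_le_pow₀ (by linarith)
  set L := X / D ^ 4 with hLdef
  have hL0 : 0 ≤ L := by positivity
  have hLX : L ≤ X := div_le_self hX0 hD4
  set ℓ := ⌊L⌋₊ with hℓ
  set s₀ := ⌊4 * L⌋₊ with hs₀
  set R := ⌈D ^ 5⌉₊ with hR
  set K := 5 * s₀ + 4 * R + 2 * ℓ + 5 with hK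
  have hℓL : (ℓ : ℝ) ≤ L := Nat.floor_le hL0
  have hLℓ : L < ℓ + 1 := Nat.lt_floor_add_one L
  have hs₀L : (s₀ : ℝ) ≤ 4 * L := Nat.floor_le (by positivity)
  have hLs₀ : 4 * L < s₀ + 1 := Nat.lt_floor_add_one _
  have hRD : D ^ 5 ≤ R := Nat.le_ceil _
  have hRD' : (R : ℝ) < D ^ 5 + 1 := Nat.ceil_lt_add_one (by positivity)
  have hD5 : 0 < D ^ 5 := by positivity
  have hℓs : 2 * ℓ + 2 ≤ s₀ := by
    have : (2 * ℓ + 2 : ℝ) < s₀ + 1 := by linarith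
    have : 2 * ℓ + 2 < s₀ + 1 := by exact_mod_cast this
    omega
  have hKL : (K : ℝ) ≤ 24 * L := by
    rw [hK]
    push_cast
    linarith
  set bad2 : ℕ → Set (SimpleGraph (Fin n) × (Sym2 (Fin n) → ℝ)) := fun k =>
    {x | ∃ W : Finset (Fin n), W.card = k ∧ W.card < (innerEdges x.1 W).card} with hbad2
  set bad3 : ℕ → Set (SimpleGraph (Fin n) × (Sym2 (Fin n) → ℝ)) := fun k =>
    {x | ∃ W : Finset (Fin n), W.card = k ∧ W.card ≤ (innerEdges x.1 W).card + 1 ∧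
        -Real.log (1 - ε / 4) / 16 * W.card ≤ ∑ u ∈ W, heavyLog d ε x.1 x.2 β u} with hbad3
  set bad4 : ℕ → Set (SimpleGraph (Fin n) × (Sym2 (Fin n) → ℝ)) := fun k =>
    {x | ∃ W : Finset (Fin n), W.card = k ∧ W.card ≤ (innerEdges x.1 W).card + 1 ∧
        X / D ^ 2 < setUpsilon x.1 x.2 β W} with hbad4
  set bad5 : Set (SimpleGraph (Fin n) × (Sym2 (Fin n) → ℝ)) :=
    {x | ∃ e, |x.2 e| < (n : ℝ) ^ (-(7 / 3) : ℝ) ∨ 10 * Real.sqrt X < |x.2 e|} with hbad5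
  have hsub : {x : SimpleGraph (Fin n) × (Sym2 (Fin n) → ℝ) | ¬ MemClass d ε x.1 x.2 β} ⊆
      (((⋃ k ∈ Finset.Icc 1 K, bad2 k) ∪ ⋃ k ∈ Finset.Icc (ℓ + 1) n, bad3 k) ∪
        ⋃ k ∈ Finset.Icc 1 (ℓ + 1), bad4 k) ∪ bad5 := by
    intro x hx
    by_contra hcon
    simp only [Set.mem_union, Set.mem_iUnion, not_or, not_exists] at hcon
    obtain ⟨⟨⟨h2, h3⟩, h4⟩, h5⟩ := hcon
    exact hx (memClass_of_not_bad hε hε1 (by linarith) hD hX (by linarith) hRD hs₀L hℓ hℓs hK.ge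
      h2 h3 h4 (by simpa [hbad5] using h5))
  have h2 : law n d (⋃ k ∈ Finset.Icc 1 K, bad2 k) ≤
      ENNReal.ofReal (K * (2 * d * Real.exp (-(7 / 8) * X))) := by
    refine (measure_biUnion_finset_le _ _).trans ((Finset.sum_le_card_nsmul _ _
      (ENNReal.ofReal (2 * d * Real.exp (-(7 / 8) * X))) fun k hk => ?_).trans ?_)
    · rw [Finset.mem_Icc] at hk
      exact law_exists_dense_le_exp hD hD20 hd64 hdn hn hX hKL hk.2 hk.1
    · rw [Nat.card_Icc, Nat.add_sub_cancel, nsmul_eq_mul, ENNReal.ofReal_mul (Nat.cast_nonneg K),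
        ENNReal.ofReal_natCast]
  have h3 : law n d (⋃ k ∈ Finset.Icc (ℓ + 1) n, bad3 k) ≤
      ENNReal.ofReal (n * Real.exp (-3 * X)) := by
    refine (measure_biUnion_finset_le _ _).trans ((Finset.sum_le_card_nsmul _ _
      (ENNReal.ofReal (Real.exp (-3 * X))) fun k hk => ?_).trans ?_)
    · rw [Finset.mem_Icc] at hk
      have hk' : (ℓ + 1 : ℝ) ≤ k := by exact_mod_cast hk.1
      exact law_exists_heavy_le_exp hε hε1 hD hD20 hDd hcD hd64 hdn hn hβ hβc hX
        (hLℓ.le.trans hk') (by omega)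
    · rw [Nat.card_Icc, nsmul_eq_mul, ENNReal.ofReal_mul (Nat.cast_nonneg n),
        ENNReal.ofReal_natCast]
      gcongr
      omega
  have h4 : law n d (⋃ k ∈ Finset.Icc 1 (ℓ + 1), bad4 k) ≤
      ENNReal.ofReal (n * Real.exp (-2 * X)) := by
    refine (measure_biUnion_finset_le _ _).trans ((Finset.sum_le_card_nsmul _ _
      (ENNReal.ofReal (Real.exp (-2 * X))) fun k hk => ?_).trans ?_)
    · rw [Finset.mem_Icc] at hk
      have hk' : (k : ℝ) ≤ ℓ + 1 := by exact_mod_cast hk.2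
      exact law_exists_setUpsilon_le_exp hε hD hD20 hDd' hd64 hdn hn hβ hβc hX
        (by linarith) hk.1
    · have hℓn : ℓ + 1 ≤ n := by
        have h6 := Real.add_one_le_exp X
        rw [← hnX] at h6
        have h7 : (ℓ + 1 : ℝ) ≤ n := by linarith
        exact_mod_cast h7
      rw [Nat.card_Icc, nsmul_eq_mul, ENNReal.ofReal_mul (Nat.cast_nonneg n),
        ENNReal.ofReal_natCast]
      gcongr
      omega
  have h5 : law n d bad5 ≤ ENNReal.ofReal (4 * Real.exp (-(1 / 3) * X)) :=
    law_exists_coupling_le_exp hn hX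
  refine (measure_mono hsub).trans ?_
  refine (measure_union_le _ _).trans ((add_le_add ((measure_union_le _ _).trans (add_le_add
    ((measure_union_le _ _).trans (add_le_add h2 h3)) h4)) h5).trans ?_)
  rw [← ENNReal.ofReal_add (by positivity) (by positivity),
    ← ENNReal.ofReal_add (by positivity) (by positivity),
    ← ENNReal.ofReal_add (by positivity) (by positivity)]
  refine ENNReal.ofReal_le_ofReal ?_
  have e2 : K * (2 * d * Real.exp (-(7 / 8) * X)) ≤ Real.exp (-(1 / 4) * X) / 4 := by
    have h6 : (K : ℝ) * (2 * d) ≤ Real.exp (X / 2) * (Real.exp (X / 8) / 8) := by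
      refine mul_le_mul ?_ (by linarith) (by positivity) (by positivity)
      have h7 := Real.quadratic_le_exp_of_nonneg (show 0 ≤ X / 2 by positivity)
      have h8 : L ≤ X / 160000 := by
        have h9 := pow_le_pow_left₀ (by norm_num) hD20 4
        exact div_le_div_of_nonneg_left hX0 (by norm_num) (by linarith)
      nlinarith
    calc K * (2 * d * Real.exp (-(7 / 8) * X)) = K * (2 * d) * Real.exp (-(7 / 8) * X) := by ring
      _ ≤ Real.exp (X / 2) * (Real.exp (X / 8) / 8) * Real.exp (-(7 / 8) * X) := by gcongr
      _ = Real.exp (X / 2 + X / 8 + -(7 / 8) * X) / 8 := by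
          rw [Real.exp_add, Real.exp_add]; ring
      _ = Real.exp (-(1 / 4) * X) / 8 := by ring_nf
      _ ≤ _ := by linarith [Real.exp_pos (-(1 / 4) * X)]
  have hfour : ∀ a : ℝ, a ≤ -(1 / 3) * X → 4 * Real.exp a ≤ Real.exp (-(1 / 4) * X) / 4 := by
    intro a ha
    -- `16 ≤ exp 3 ≤ exp (X / 12)`
    have h6 : (16 : ℝ) ≤ Real.exp (X / 12) := by
      have h7 : Real.exp 3 = Real.exp 1 * Real.exp 1 * Real.exp 1 := by
        rw [← Real.exp_add, ← Real.exp_add]; norm_num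
      have h8 : Real.exp 3 ≤ Real.exp (X / 12) := Real.exp_le_exp.2 (by linarith)
      have h9 := Real.exp_one_gt_d9
      have h10 : (2.7 : ℝ) * 2.7 * 2.7 ≤ Real.exp 1 * Real.exp 1 * Real.exp 1 := by
        gcongr <;> linarith
      linarith
    have h7 : Real.exp a * Real.exp (X / 12) ≤ Real.exp (-(1 / 4) * X) := by
      rw [← Real.exp_add]
      exact Real.exp_le_exp.2 (by linarith)
    have := mul_le_mul_of_nonneg_left h6 (Real.exp_pos a).le
    linarith
  have e3 : n * Real.exp (-3 * X) ≤ Real.exp (-(1 / 4) * X) / 4 := by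
    rw [hnX, ← Real.exp_add]
    have := hfour (X + -3 * X) (by linarith)
    linarith [Real.exp_pos (X + -3 * X)]
  have e4 : n * Real.exp (-2 * X) ≤ Real.exp (-(1 / 4) * X) / 4 := by
    rw [hnX, ← Real.exp_add]
    have := hfour (X + -2 * X) (by linarith)
    linarith [Real.exp_pos (X + -2 * X)]
  have e5 := hfour (-(1 / 3) * X) le_rfl
  linarith

end Main

instance (n : ℕ) (d : ℝ) : IsProbabilityMeasure (law n d) := by
  unfold law
  infer_instance

lemma eventually_parameters {ε : ℝ} (hε : 0 < ε) (hε1 : ε < 1) :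
    ∀ᶠ d : ℝ in Filter.atTop, 20 ≤ Real.log d ∧ 1600 * Real.log d ^ 6 ≤ d * ε ^ 2 ∧
      5 ≤ -Real.log (1 - ε / 4) / 16 * Real.log d := by
  have hc : 0 < -Real.log (1 - ε / 4) / 16 := by
    have := Real.log_neg (show 0 < 1 - ε / 4 by linarith) (by linarith)
    linarith
  have h1 := Real.tendsto_log_atTop.eventually_ge_atTop 20
  have h2 := Real.tendsto_log_atTop.eventually_ge_atTop (5 / (-Real.log (1 - ε / 4) / 16))
  have h3 := (Real.isLittleO_pow_log_id_atTop (n := 6)).bound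
    (show (0 : ℝ) < ε ^ 2 / 1600 by positivity)
  filter_upwards [h1, h2, h3, Filter.eventually_ge_atTop 0] with d h1 h2 h3 h4
  refine ⟨h1, ?_, ?_⟩
  · rw [Real.norm_of_nonneg (by positivity), id, Real.norm_of_nonneg h4] at h3
    linarith
  · rw [div_le_iff₀ hc] at h2
    linarith

lemma eventually_log_ge (c : ℝ) : ∀ᶠ n : ℕ in Filter.atTop, c ≤ Real.log n :=
  (Real.tendsto_log_atTop.comp tendsto_natCast_atTop_atTop).eventually_ge_atTop c

end EdwardsAnderson

end

theorem mainTheorem2 (ε : ℝ) (hε : 0 < ε) :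
    ∃ d₀ : ℝ, 1 ≤ d₀ ∧ ∀ d : ℝ, d₀ ≤ d →
      ∃ n₀ : ℕ, ∀ β : ℝ, 0 < β → β ≤ (1 - ε) * EdwardsAnderson.betaC d →
        ∀ n : ℕ, n₀ ≤ n →
          1 - (n : ℝ) ^ (-(1 / 4) : ℝ) ≤
            (EdwardsAnderson.law n d).real
              {x | EdwardsAnderson.MemClass d ε x.1 x.2 β} := by
  rcases le_or_gt 1 ε with hε1 | hε1
  · -- there is no admissible `β`
    refine ⟨1, le_rfl, fun d hd => ⟨0, fun β hβ hβc => ?_⟩⟩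
    have : 0 ≤ EdwardsAnderson.betaC d := div_nonneg (Real.sqrt_nonneg _) (by linarith)
    nlinarith
  obtain ⟨d₁, hd₁⟩ := Filter.eventually_atTop.1 (EdwardsAnderson.eventually_parameters hε hε1)
  refine ⟨max 1 d₁, le_max_left _ _, fun d hd => ?_⟩
  obtain ⟨hD20, hDd, hcD⟩ := hd₁ d ((le_max_right _ _).trans hd)
  have hd0 : 0 < d := one_pos.trans_le ((le_max_left _ _).trans hd)
  obtain ⟨n₁, hn₁⟩ := Filter.eventually_atTop.1
    ((EdwardsAnderson.eventually_log_ge (max (max (Real.log d) 36)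
      (max (8 * Real.log (16 * d)) ((2 * Real.log d ^ 5 + 8) * Real.log d ^ 4)))).and
      (Filter.eventually_gt_atTop 0))
  refine ⟨n₁, fun β hβ hβc n hn => ?_⟩
  obtain ⟨hX, hn0⟩ := hn₁ n hn
  simp only [max_le_iff] at hX
  obtain ⟨⟨hX1, hX2⟩, hX3, hX4⟩ := hX
  have hbad := EdwardsAnderson.law_not_memClass_le hε hε1 rfl hD20 hDd hcD hn0 hβ hβc rfl hX1 hX2
    (by
      rw [← Real.exp_log (show 0 < 16 * d by positivity)]
      exact Real.exp_le_exp.2 (by linarith))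
    (by
      rw [le_div_iff₀ (pow_pos (by linarith) 4)]
      exact hX4)
  have hpow : (n : ℝ) ^ (-(1 / 4) : ℝ) = Real.exp (-(1 / 4) * Real.log n) := by
    rw [Real.rpow_def_of_pos (Nat.cast_pos.2 hn0), mul_comm]
  rw [hpow, Measure.real, ← ENNReal.ofReal_le_iff_le_toReal (measure_ne_top _ _),
    ENNReal.ofReal_sub _ (Real.exp_pos _).le, ENNReal.ofReal_one, tsub_le_iff_right,
    ← measure_univ (μ := EdwardsAnderson.law n d)]
  -- subadditivity suffices, so that no measurability of the event is needed
  refine le_trans (measure_mono ?_) ((measure_union_le _ _).trans (add_le_add_right hbad _))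
  exact fun x _ => Classical.em _
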